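/- Let $T$ be a set. Let $\mathrm{FRg}(T)$ be the category whose objects (contexts) are triples $\Gamma=(n,S,\tau)$ with $n\in\mathbb N$, $S\subseteq T$ finite and $\tau:\{1,\dots,n\}\to S$, and whose morphisms $(n,S,\tau)\to(n',S',\tau')$ exist only if $S'\subseteq S$ and are then the functions $f:\{1,\dots,n'\}\to\{1,\dots,n\}$ with $\tau\circ f=\tau'$ (as maps to $T$). It is the free regular category on $T$; its terminal object is $0=(0,\emptyset,!)$, and its products are written $\oplus$. Let $\mathbb{FRg}(T)$ be its po-category (category enriched in posets) of relations: the objects are those of $\mathrm{FRg}(T)$, the morphisms $\Gamma\to\Gamma'$ are the subobjects of $\Gamma\oplus\Gamma'$ ordered by inclusion, relations are composed by pullback followed by image, and the symmetric monoidal structure is given by $\oplus$. A *regular calculus* on $T$ is a po-functor $P:\mathbb{FRg}(T)\to\mathbb{P}\mathrm{oset}$ that is lax symmetric monoidal (for the cartesian product of posets) and whose laxators $1\to P(0)$ and $\rho:P(\Gamma)\times P(\Gamma')\to P(\Gamma\oplus\Gamma')$ are right adjoints. Each $P(\Gamma)$ then has a top element $\mathrm{true}$. For a morphism $f$ of $\mathrm{FRg}(T)$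 write $f_!=P(\text{graph of }f)$. Let $\mathbb{I}\mathrm{ntRel}_P$ be the po-category whose objects are the pairs $(\Gamma,\varphi)$ with $\varphi\in P(\Gamma)$, and whose morphisms $(\Gamma_1,\varphi_1)\to(\Gamma_2,\varphi_2)$ are the $\theta\in P(\Gamma_1\oplus\Gamma_2)$ with $(\pi_1)_!\theta\le\varphi_1$ and $(\pi_2)_!\theta\le\varphi_2$, ordered as in $P(\Gamma_1\oplus\Gamma_2)$. The identity of $(\Gamma,\varphi)$ is $(\delta_\Gamma)_!\varphi$, where $\delta_\Gamma$ is the diagonal. The composite of $\theta\in P(\Gamma_1\oplus\Gamma_2)$ and $\theta'\in P(\Gamma_2\oplus\Gamma_3)$ is $\theta\mathbin{;}\theta'=P(\mathrm{comp})(\rho(\theta,\theta'))$, where $\mathrm{comp}:\Gamma_1\oplus\Gamma_2\oplus\Gamma_2\oplus\Gamma_3\to\Gamma_1\oplus\Gamma_3$ is the relation given by the span of the evident diagonal and projection maps out of $\Gamma_1\oplus\Gamma_2\oplus\Gamma_3$. Let $\mathcal R_P$ be the category of internal functions: it has the same objects, and its morphisms are the left adjoints in $\mathbb{I}\mathrm{ntRel}_P$.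 **Theorem.** For every regular calculus $P$ on $T$, the category $\mathcal R_P$ is regular: it has all finite limits, every kernel pair has a coequalizer, and regular epimorphisms are stable under pullback. Explicitly, moreover: 1. $(0,\mathrm{true})$ is a terminal object of $\mathcal R_P$. 2. For morphisms $\theta_i:(\Gamma_i,\varphi_i)\to(\Gamma,\varphi)$ of $\mathcal R_P$ ($i=1,2$), put $\theta_{12}=\theta_1\mathbin{;}\theta_2^\dagger\in P(\Gamma_1\oplus\Gamma_2)$, where $\dagger$ denotes pushforward along the symmetry. Then $(\Gamma_1\oplus\Gamma_2,\theta_{12})$, with the projections $\langle\mathrm{id},\pi_i\rangle_!(\theta_{12})$ to $(\Gamma_i,\varphi_i)$, is a pullback of $\theta_1$ and $\theta_2$. 3. For a morphism $\theta:(\Gamma_1,\varphi_1)\to(\Gamma_2,\varphi_2)$ of $\mathcal R_P$, put $\mathrm{im}(\theta)=(\pi_2)_!\theta$. Then $\theta$ is the composite of the regular epimorphism $(\Gamma_1,\varphi_1)\to(\Gamma_2,\mathrm{im}(\theta))$ given by $\theta$ and the monomorphism $(\Gamma_2,\mathrm{im}(\theta))\to(\Gamma_2,\varphi_2)$ given by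 $(\delta_{\Gamma_2})_!\,\mathrm{im}(\theta)$. -/

import Mathlib

open CategoryTheory Limits MonoidalCategory CartesianMonoidalCategory

universe w v u

/-! ## The free regular category on a set of types -/

/-- A context `n → S ⊆ T` over a set `T` of types: an arity `n`, a finite support `S ⊆ T` and a
typing function `n → S`. Contexts are the objects of `FRg(T) = (FinSet ↓ P_f(T))ᵒᵖ`. -/
structure FRg (T : Type u) where
  /-- the number of ports -/
  arity : ℕ
  /-- the support, a finite set of types -/
  support : Finset T
  /-- the type of each port, which lies in the support -/
  typing : Fin arity → support

namespace FRg

variable {T : Type u}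

/-- A morphism of contexts `(n, S, τ) ⟶ (n', S', τ')` is a function `n' → n` that is compatible
with the typings, where `S' ⊆ S` is required. -/
@[ext]
structure Hom (Γ Δ : FRg T) where
  /-- the underlying function on ports, in the opposite direction -/
  fn : Fin Δ.arity → Fin Γ.arity
  support_subset : Δ.support ⊆ Γ.support
  typing_fn : ∀ i, (Γ.typing (fn i) : T) = Δ.typing i

instance : Category.{0} (FRg T) where
  Hom := Hom
  id Γ := ⟨id, subset_rfl, fun _ => rfl⟩
  comp f g := ⟨f.fn ∘ g.fn, g.support_subset.trans f.support_subset,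
    fun i => (f.typing_fn _).trans (g.typing_fn i)⟩

@[ext]
theorem hom_ext {Γ Δ : FRg T} {f g : Γ ⟶ Δ} (h : ∀ i, f.fn i = g.fn i) : f = g :=
  Hom.ext (funext h)

@[simp]
theorem id_fn (Γ : FRg T) (i : Fin Γ.arity) : Hom.fn (𝟙 Γ) i = i := rfl

@[simp]
theorem comp_fn {Γ Δ Θ : FRg T} (f : Γ ⟶ Δ) (g : Δ ⟶ Θ) (i : Fin Θ.arity) :
    (f ≫ g).fn i = f.fn (g.fn i) := rfl

/-- The empty context `0 = (0, ∅, !)`. -/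
def zero : FRg T := ⟨0, ∅, Fin.elim0⟩

/-- The empty context is terminal. -/
def zeroIsTerminal : IsTerminal (zero : FRg T) :=
  IsTerminal.ofUniqueHom
    (fun _ => ⟨Fin.elim0, by simp [zero], fun i => Fin.elim0 i⟩)
    (fun _ _ => hom_ext fun i => Fin.elim0 i)

open Classical in
/-- The context `Γ ⊕ Δ = (n + n', S ∪ S', [τ, τ'])`. -/
noncomputable def sum (Γ Δ : FRg T) : FRg T where
  arity := Γ.arity + Δ.arity
  support := Γ.support ∪ Δ.support
  typing := Fin.addCases
    (fun i => ⟨Γ.typing i, Finset.mem_union_left _ (Γ.typing i).2⟩)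
    (fun j => ⟨Δ.typing j, Finset.mem_union_right _ (Δ.typing j).2⟩)

/-- The first projection `Γ ⊕ Δ ⟶ Γ`. -/
noncomputable def sumFst (Γ Δ : FRg T) : sum Γ Δ ⟶ Γ where
  fn := Fin.castAdd _
  support_subset := by classical exact Finset.subset_union_left
  typing_fn i := by simp [sum]

/-- The second projection `Γ ⊕ Δ ⟶ Δ`. -/
noncomputable def sumSnd (Γ Δ : FRg T) : sum Γ Δ ⟶ Δ where
  fn := Fin.natAdd _
  support_subset := by classical exact Finset.subset_union_right
  typing_fn i := by simp [sum]

/-- The pairing of two morphisms. -/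
noncomputable def sumLift {Θ Γ Δ : FRg T} (f : Θ ⟶ Γ) (g : Θ ⟶ Δ) : Θ ⟶ sum Γ Δ where
  fn := Fin.addCases f.fn g.fn
  support_subset := by classical exact Finset.union_subset f.support_subset g.support_subset
  typing_fn i := by
    refine Fin.addCases (fun i => ?_) (fun i => ?_) i
    · simp [sum, f.typing_fn]
    · simp [sum, g.typing_fn]

theorem sumLift_fst {Θ Γ Δ : FRg T} (f : Θ ⟶ Γ) (g : Θ ⟶ Δ) : sumLift f g ≫ sumFst Γ Δ = f :=
  hom_ext fun i => by simp [sumLift, sumFst]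

theorem sumLift_snd {Θ Γ Δ : FRg T} (f : Θ ⟶ Γ) (g : Θ ⟶ Δ) : sumLift f g ≫ sumSnd Γ Δ = g :=
  hom_ext fun i => by simp [sumLift, sumSnd]

/-- `Γ ⊕ Δ` is the product of `Γ` and `Δ`. -/
noncomputable def sumIsProduct (Γ Δ : FRg T) :
    IsLimit (BinaryFan.mk (sumFst Γ Δ) (sumSnd Γ Δ)) :=
  BinaryFan.IsLimit.mk _ (fun f g => sumLift f g)
    (fun f g => sumLift_fst f g) (fun f g => sumLift_snd f g)
    (fun f g m hf hg => hom_ext fun i => by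
      refine Fin.addCases (fun i => ?_) (fun i => ?_) i
      · simp [sumLift, ← hf]; rfl
      · simp [sumLift, ← hg]; rfl)

noncomputable instance : CartesianMonoidalCategory (FRg T) :=
  .ofChosenFiniteProducts ⟨asEmptyCone zero, zeroIsTerminal⟩ fun Γ Δ => ⟨_, sumIsProduct Γ Δ⟩

/-- A finite type with a typing, as a context. -/
noncomputable def ofFinite {ι : Type} [Finite ι] (S : Finset T) (τ : ι → S) : FRg T :=
  ⟨Nat.card ι, S, τ ∘ (Finite.equivFin ι).symm⟩

/-- The ports of `ofFinite S τ`. -/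
noncomputable def port {ι : Type} [Finite ι] (S : Finset T) (τ : ι → S) :
    ι ≃ Fin (ofFinite S τ).arity :=
  Finite.equivFin ι

theorem typing_port {ι : Type} [Finite ι] (S : Finset T) (τ : ι → S) (x : ι) :
    (ofFinite S τ).typing (port S τ x) = τ x :=
  congrArg τ ((Finite.equivFin ι).symm_apply_apply x)

theorem surjective_fn {Γ Δ : FRg T} (f : Γ ⟶ Δ) [Mono f] : Function.Surjective f.fn := by
  classical
  intro j
  by_contra hj
  let g₁ : sum Γ Γ ⟶ Γ := sumFst Γ Γ
  let g₂ : sum Γ Γ ⟶ Γ := {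
    fn := fun k => if ∃ i, f.fn i = k then (sumFst Γ Γ).fn k else (sumSnd Γ Γ).fn k
    support_subset := g₁.support_subset
    typing_fn := fun k => by
      by_cases h : ∃ i, f.fn i = k
      · rw [if_pos h]; exact (sumFst Γ Γ).typing_fn k
      · rw [if_neg h]; exact (sumSnd Γ Γ).typing_fn k }
  have h : g₁ ≫ f = g₂ ≫ f := hom_ext fun i => (if_pos ⟨i, rfl⟩ : g₂.fn (f.fn i) = _).symm
  have h' : g₁.fn j = g₂.fn j := by rw [(cancel_mono f).1 h]
  have h₂ : g₂.fn j = (sumSnd Γ Γ).fn j := if_neg hj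
  have := congrArg Fin.val (h'.trans h₂)
  have hlt := j.2
  simp [g₁, sumFst, sumSnd] at this
  omega

instance : HasEqualizers (FRg T) := by
  classical
  refine @hasEqualizers_of_hasLimit_parallelPair (FRg T) _ fun {Γ Δ f g} => ?_
  let r : Fin Γ.arity → Fin Γ.arity → Prop := fun a b => ∃ i, f.fn i = a ∧ g.fn i = b
  have hr : ∀ a b, r a b → Γ.typing a = Γ.typing b := by
    rintro _ _ ⟨i, rfl, rfl⟩
    exact Subtype.ext ((f.typing_fn i).trans (g.typing_fn i).symm)
  let E : FRg T := ofFinite (ι := Quot r) Γ.support (Quot.lift Γ.typing hr)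
  let e : Quot r ≃ Fin E.arity := port _ _
  let ι : E ⟶ Γ := {
    fn := fun a => e (Quot.mk r a)
    support_subset := subset_rfl
    typing_fn := fun a => congrArg Subtype.val (typing_port Γ.support (Quot.lift Γ.typing hr) (Quot.mk r a)) }
  have hι : ι ≫ f = ι ≫ g := hom_ext fun i =>
    congrArg e (Quot.sound ⟨i, rfl, rfl⟩)
  refine ⟨⟨Fork.ofι ι hι, Fork.IsLimit.mk' _ fun s => ?_⟩⟩
  have hs : ∀ a b, r a b → s.ι.fn a = s.ι.fn b := by
    rintro _ _ ⟨i, rfl, rfl⟩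
    exact congrFun (congrArg Hom.fn s.condition) i
  refine ⟨{ fn := fun k => Quot.lift s.ι.fn hs (e.symm k)
            support_subset := s.ι.support_subset
            typing_fn := fun k => ?_ }, ?_, ?_⟩
  · obtain ⟨q, rfl⟩ := e.surjective k
    obtain ⟨a, rfl⟩ := Quot.exists_rep q
    have h := ι.typing_fn a
    simp only [Equiv.symm_apply_apply]
    exact (s.ι.typing_fn a).trans h.symm
  · exact hom_ext fun i => by simp [ι]
  · intro m hm
    refine hom_ext fun k => ?_
    obtain ⟨q, rfl⟩ := e.surjective k
    obtain ⟨a, rfl⟩ := Quot.exists_rep q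
    simp [← hm, ι]

instance : HasFiniteProducts (FRg T) :=
  hasFiniteProducts_of_has_binary_and_terminal

instance : HasPullbacks (FRg T) := hasPullbacks_of_hasBinaryProducts_of_hasEqualizers _

instance : HasImages (FRg T) where
  has_image {Γ Δ} f := by
    classical
        let I : FRg T := ofFinite (ι := Set.range f.fn) Γ.support fun a => Γ.typing a
    let e : Set.range f.fn ≃ Fin I.arity := port _ _
    let m : I ⟶ Δ := {
      fn := fun i => e ⟨f.fn i, i, rfl⟩
      support_subset := f.support_subset
      typing_fn := fun i => (congrArg Subtype.val (typing_port Γ.support _ _)).trans (f.typing_fn i) }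
    have : Mono m := ⟨fun {Z} g h w => by
      refine hom_ext fun k => ?_
      obtain ⟨⟨_, i, rfl⟩, rfl⟩ := e.surjective k
      exact congrFun (congrArg Hom.fn w) i⟩
    let p : Γ ⟶ I := {
      fn := fun k => (e.symm k : Fin Γ.arity)
      support_subset := subset_rfl
      typing_fn := fun k => rfl }
    let F : MonoFactorisation f := ⟨I, m, p, hom_ext fun i =>
      congrArg Subtype.val (e.symm_apply_apply ⟨f.fn i, i, rfl⟩)⟩
    refine HasImage.mk ⟨F, ⟨fun F' => ?_, fun F' => ?_⟩⟩
    · have hmem : ∀ k, F'.e.fn k ∈ Set.range f.fn := fun k => by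
        have := F'.m_mono
        obtain ⟨i, rfl⟩ := surjective_fn F'.m k
        exact ⟨i, by rw [← comp_fn, F'.fac]⟩
      exact {
        fn := fun k => e ⟨F'.e.fn k, hmem k⟩
        support_subset := F'.e.support_subset
        typing_fn := fun k =>
          (congrArg Subtype.val (typing_port Γ.support _ _)).trans (F'.e.typing_fn k) }
    · refine hom_ext fun i => ?_
      simp only [comp_fn, F, m]
      congr 2
      rw [← comp_fn, F'.fac]

end FRg

/-! ## Relations -/

set_option linter.unusedSectionVars false

section Relations

variable {C : Type u} [Category.{v} C] [CartesianMonoidalCategory C] [HasPullbacks C] [HasImages C]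

/-- A relation `X ⇸ Y` is a subobject of `X × Y`; relations are ordered by inclusion. -/
abbrev Relation (X Y : C) := Subobject (X ⊗ Y)

/-- A criterion for a commutative square to be a pullback. -/
theorem isPullback_of {D X Y Z : C} {p : D ⟶ X} {q : D ⟶ Y} {f : X ⟶ Z} {g : Y ⟶ Z}
    (w : p ≫ f = q ≫ g)
    (h : ∀ {A : C} (a : A ⟶ X) (b : A ⟶ Y), a ≫ f = b ≫ g → ∃ l : A ⟶ D, l ≫ p = a ∧ l ≫ q = b)
    (h' : ∀ {A : C} (l l' : A ⟶ D), l ≫ p = l' ≫ p → l ≫ q = l' ≫ q → l = l') :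
    IsPullback p q f g :=
  ⟨⟨w⟩, ⟨PullbackCone.IsLimit.mk w (fun s => (h s.fst s.snd s.condition).choose)
    (fun s => (h s.fst s.snd s.condition).choose_spec.1)
    (fun s => (h s.fst s.snd s.condition).choose_spec.2)
    (fun s _ hm hm' => h' _ _ (hm.trans (h s.fst s.snd s.condition).choose_spec.1.symm)
      (hm'.trans (h s.fst s.snd s.condition).choose_spec.2.symm))⟩⟩

namespace Relation

/-- The relation given by a span `X ← A → Y`: the image of `A → X × Y`. -/
noncomputable def ofSpan {A X Y : C} (f : A ⟶ X) (g : A ⟶ Y) : Relation X Y :=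
  imageSubobject (lift f g)

/-- The left leg of a relation. -/
noncomputable def left {X Y : C} (R : Relation X Y) : (R : C) ⟶ X := R.arrow ≫ fst X Y

/-- The right leg of a relation. -/
noncomputable def right {X Y : C} (R : Relation X Y) : (R : C) ⟶ Y := R.arrow ≫ snd X Y

/-- The graph `⟨id, f⟩` of a morphism. -/
noncomputable def graph {X Y : C} (f : X ⟶ Y) : Relation X Y := ofSpan (𝟙 X) f

/-- The co-graph `⟨f, id⟩` of a morphism. -/
noncomputable def cograph {X Y : C} (f : X ⟶ Y) : Relation Y X := ofSpan f (𝟙 X)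

/-- The identity relation, i.e. the diagonal. -/
noncomputable def id (X : C) : Relation X X := ofSpan (𝟙 X) (𝟙 X)

/-- The composite of relations `R : X ⇸ Y` and `S : Y ⇸ Z` (in diagrammatic order): pull back
over `Y` and take the image in `X × Z`. -/
noncomputable def comp {X Y Z : C} (R : Relation X Y) (S : Relation Y Z) : Relation X Z :=
  ofSpan (pullback.fst R.right S.left ≫ R.left) (pullback.snd R.right S.left ≫ S.right)

/-- The monoidal product of relations `R : X ⇸ Y` and `R' : X' ⇸ Y'`, i.e. the product
`R × R'` as a subobject of `(X × X') × (Y × Y')`. -/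
noncomputable def tensor {X Y X' Y' : C} (R : Relation X Y) (R' : Relation X' Y') :
    Relation (X ⊗ X') (Y ⊗ Y') :=
  ofSpan (R.left ⊗ₘ R'.left) (R.right ⊗ₘ R'.right)

theorem ofSpan_comp_le {A B X Y : C} (h : A ⟶ B) (f : B ⟶ X) (g : B ⟶ Y) :
    ofSpan (h ≫ f) (h ≫ g) ≤ ofSpan f g := by
  unfold ofSpan
  exact imageSubobject_le _ (h ≫ factorThruImageSubobject (lift f g)) (by simp)

theorem ofSpan_iso {A B X Y : C} (h : A ≅ B) (f : B ⟶ X) (g : B ⟶ Y) :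
    ofSpan (h.hom ≫ f) (h.hom ≫ g) = ofSpan f g := by
  refine le_antisymm (ofSpan_comp_le _ _ _) ?_
  simpa using ofSpan_comp_le h.inv (h.hom ≫ f) (h.hom ≫ g)

theorem ofSpan_left_right {X Y : C} (R : Relation X Y) : ofSpan R.left R.right = R := by
  simp [ofSpan, left, right, imageSubobject_mono, Subobject.mk_arrow]

/-- A jointly monic span is, up to isomorphism, the relation which it defines. -/
theorem exists_iso {A X Y : C} (f : A ⟶ X) (g : A ⟶ Y) [Mono (lift f g)] :
    ∃ e : ((ofSpan f g : Relation X Y) : C) ≅ A,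
      (ofSpan f g).left = e.hom ≫ f ∧ (ofSpan f g).right = e.hom ≫ g := by
  have h : ofSpan f g = Subobject.mk (lift f g) := imageSubobject_mono _
  rw [h]
  refine ⟨Subobject.underlyingIso _, ?_, ?_⟩
  · rw [left, ← Subobject.underlyingIso_hom_comp_eq_mk]; simp
  · rw [right, ← Subobject.underlyingIso_hom_comp_eq_mk]; simp

theorem comp_ofSpan {A B D X Y Z : C} (f : A ⟶ X) (g : A ⟶ Y) (h : B ⟶ Y) (k : B ⟶ Z)
    [Mono (lift f g)] [Mono (lift h k)] {p : D ⟶ A} {q : D ⟶ B} (sq : IsPullback p q g h) :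
    comp (ofSpan f g) (ofSpan h k) = ofSpan (p ≫ f) (q ≫ k) := by
  obtain ⟨e, he₁, he₂⟩ := exists_iso f g
  obtain ⟨e', he₁', he₂'⟩ := exists_iso h k
  have sq' : IsPullback (p ≫ e.inv) (q ≫ e'.inv) (ofSpan f g).right (ofSpan h k).left :=
    sq.of_iso (Iso.refl _) e.symm e'.symm (Iso.refl _) (by simp) (by simp) (by simp [he₂])
      (by simp [he₁'])
  unfold comp
  rw [← ofSpan_iso sq'.isoPullback]
  simp [he₁, he₂']

theorem tensor_ofSpan {A B X Y X' Y' : C} (f : A ⟶ X) (g : A ⟶ Y) (h : B ⟶ X') (k : B ⟶ Y')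
    [Mono (lift f g)] [Mono (lift h k)] :
    tensor (ofSpan f g) (ofSpan h k) = ofSpan (f ⊗ₘ h) (g ⊗ₘ k) := by
  obtain ⟨e, he₁, he₂⟩ := exists_iso f g
  obtain ⟨e', he₁', he₂'⟩ := exists_iso h k
  unfold tensor
  rw [← ofSpan_iso (MonoidalCategory.tensorIso e e') (f ⊗ₘ h)]
  simp [he₁, he₂, he₁', he₂']

theorem id_eq_graph (X : C) : id X = graph (𝟙 X) := rfl

theorem id_eq_cograph (X : C) : id X = cograph (𝟙 X) := rfl

theorem graph_comp {X Y Z : C} (f : X ⟶ Y) (g : Y ⟶ Z) :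
    (graph f).comp (graph g) = graph (f ≫ g) := by
  have h : IsPullback (𝟙 X) f f (𝟙 Y) := IsPullback.of_horiz_isIso ⟨by simp⟩
  simpa [graph] using comp_ofSpan (𝟙 X) f (𝟙 Y) g h

theorem cograph_comp {X Y Z : C} (f : X ⟶ Y) (g : Y ⟶ Z) :
    (cograph g).comp (cograph f) = cograph (f ≫ g) := by
  have h : IsPullback f (𝟙 X) (𝟙 Y) f := IsPullback.of_vert_isIso ⟨by simp⟩
  simpa [cograph] using comp_ofSpan g (𝟙 Y) f (𝟙 X) h

theorem cograph_comp_graph {A X Y : C} (f : A ⟶ X) (g : A ⟶ Y) :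
    (cograph f).comp (graph g) = ofSpan f g := by
  have h : IsPullback (𝟙 A) (𝟙 A) (𝟙 A) (𝟙 A) := IsPullback.of_vert_isIso ⟨by simp⟩
  simpa [cograph, graph] using comp_ofSpan f (𝟙 A) (𝟙 A) g h

theorem graph_comp_cograph {D X Y Z : C} {f : X ⟶ Z} {g : Y ⟶ Z} {p : D ⟶ X} {q : D ⟶ Y}
    (sq : IsPullback p q f g) : (graph f).comp (cograph g) = (cograph p).comp (graph q) := by
  rw [cograph_comp_graph]
  simpa [cograph, graph] using comp_ofSpan (𝟙 X) f g (𝟙 Y) sq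

theorem tensor_graph {X Y X' Y' : C} (f : X ⟶ Y) (g : X' ⟶ Y') :
    (graph f).tensor (graph g) = graph (f ⊗ₘ g) := by
  simpa [graph] using tensor_ofSpan (𝟙 X) f (𝟙 X') g

theorem tensor_cograph {X Y X' Y' : C} (f : X ⟶ Y) (g : X' ⟶ Y') :
    (cograph f).tensor (cograph g) = cograph (f ⊗ₘ g) := by
  simpa [cograph] using tensor_ofSpan f (𝟙 X) g (𝟙 X')

theorem id_le_graph_comp_cograph {X Y : C} (f : X ⟶ Y) : id X ≤ (graph f).comp (cograph f) := by
  rw [graph_comp_cograph (IsPullback.of_hasPullback f f), cograph_comp_graph]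
  have h := ofSpan_comp_le (pullback.lift (𝟙 X) (𝟙 X) rfl) (pullback.fst f f) (pullback.snd f f)
  rwa [pullback.lift_fst, pullback.lift_snd] at h

theorem cograph_comp_graph_le_id {X Y : C} (f : X ⟶ Y) :
    (cograph f).comp (graph f) ≤ id Y := by
  rw [cograph_comp_graph]
  simpa [id] using ofSpan_comp_le f (𝟙 Y) (𝟙 Y)

end Relation

/-! ## Ajax po-functors and regular calculi -/

variable (C) in
/-- An ajax (adjoint-lax symmetric monoidal) po-functor from the symmetric monoidal po-category of
relations in `C` to the po-category of posets (monoidal under the cartesian product): a po-functor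
`P` with natural and coherent laxators `1 → P(I)` and `P(X) × P(Y) → P(X ⊗ Y)`, both of which are
right adjoints. The structure isomorphisms of the monoidal po-category of relations are the graphs
of those of the cartesian monoidal category `C`. -/
structure AjaxFunctor where
  /-- the action on objects -/
  obj : C → PartOrd.{w}
  /-- the action on relations -/
  map : ∀ {X Y : C}, Relation X Y → (obj X →o obj Y)
  map_mono : ∀ {X Y : C} {R S : Relation X Y}, R ≤ S → map R ≤ map S
  map_id : ∀ X : C, map (Relation.id X) = OrderHom.id
  map_comp : ∀ {X Y Z : C} (R : Relation X Y) (S : Relation Y Z),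
    map (R.comp S) = (map S).comp (map R)
  /-- the nullary laxator `1 → P(I)` -/
  unit : obj (𝟙_ C)
  /-- the binary laxator `P(X) × P(Y) → P(X ⊗ Y)` -/
  lax : ∀ X Y : C, obj X × obj Y →o obj (X ⊗ Y)
  lax_natural : ∀ {X Y X' Y' : C} (R : Relation X Y) (R' : Relation X' Y') (a : obj X)
    (b : obj X'), map (R.tensor R') (lax X X' (a, b)) = lax Y Y' (map R a, map R' b)
  lax_assoc : ∀ (X Y Z : C) (a : obj X) (b : obj Y) (c : obj Z),
    map (Relation.graph (α_ X Y Z).hom) (lax (X ⊗ Y) Z (lax X Y (a, b), c)) =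
      lax X (Y ⊗ Z) (a, lax Y Z (b, c))
  lax_left_unit : ∀ (X : C) (a : obj X),
    map (Relation.graph (λ_ X).hom) (lax (𝟙_ C) X (unit, a)) = a
  lax_right_unit : ∀ (X : C) (a : obj X),
    map (Relation.graph (ρ_ X).hom) (lax X (𝟙_ C) (a, unit)) = a
  lax_symm : ∀ (X Y : C) (a : obj X) (b : obj Y),
    map (Relation.graph (lift (snd X Y) (fst X Y))) (lax X Y (a, b)) = lax Y X (b, a)
  /-- the nullary laxator has a left adjoint -/
  unit_adj : ∃ l : obj (𝟙_ C) → PUnit.{1}, GaloisConnection l fun _ => unit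
  /-- the binary laxator has a left adjoint -/
  lax_adj : ∀ X Y : C, ∃ l : obj (X ⊗ Y) → obj X × obj Y, GaloisConnection l (lax X Y)

/-- A regular calculus on a set `T` of types: an ajax po-functor from the free regular po-category
on `T`, i.e. the po-category of relations in `FRg(T)`, to posets. -/
abbrev RegularCalculus (T : Type u) := AjaxFunctor.{w} (FRg T)

namespace AjaxFunctor

variable (P : AjaxFunctor.{w} C)

/-- The pushforward `f_!` along a morphism. -/
noncomputable def push {X Y : C} (f : X ⟶ Y) : P.obj X →o P.obj Y := P.map (Relation.graph f)

/-- The pullback `f^*` along a morphism. -/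
noncomputable def pull {X Y : C} (f : X ⟶ Y) : P.obj Y →o P.obj X := P.map (Relation.cograph f)

theorem push_id {X : C} (a : P.obj X) : P.push (𝟙 X) a = a := by
  rw [push, ← Relation.id_eq_graph, P.map_id]; rfl

theorem pull_id {X : C} (a : P.obj X) : P.pull (𝟙 X) a = a := by
  rw [pull, ← Relation.id_eq_cograph, P.map_id]; rfl

theorem push_push {X Y Z : C} (f : X ⟶ Y) (g : Y ⟶ Z) (a : P.obj X) :
    P.push g (P.push f a) = P.push (f ≫ g) a := by
  rw [push, push, push, ← Relation.graph_comp, P.map_comp]; rfl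

theorem pull_pull {X Y Z : C} (f : X ⟶ Y) (g : Y ⟶ Z) (a : P.obj Z) :
    P.pull f (P.pull g a) = P.pull (f ≫ g) a := by
  rw [pull, pull, pull, ← Relation.cograph_comp, P.map_comp]; rfl

theorem map_ofSpan {A X Y : C} (f : A ⟶ X) (g : A ⟶ Y) (a : P.obj X) :
    P.map (Relation.ofSpan f g) a = P.push g (P.pull f a) := by
  rw [← Relation.cograph_comp_graph, P.map_comp]; rfl

theorem gc {X Y : C} (f : X ⟶ Y) : GaloisConnection (P.push f) (P.pull f) := by
  refine GaloisConnection.monotone_intro (P.pull f).monotone (P.push f).monotone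
    (fun a => ?_) (fun b => ?_)
  · have h := P.map_mono (Relation.id_le_graph_comp_cograph f) a
    rwa [P.map_id, P.map_comp] at h
  · have h := P.map_mono (Relation.cograph_comp_graph_le_id f) b
    rwa [P.map_id, P.map_comp] at h

/-- The Beck–Chevalley condition. -/
theorem pull_push {D X Y Z : C} {f : X ⟶ Z} {g : Y ⟶ Z} {p : D ⟶ X} {q : D ⟶ Y}
    (sq : IsPullback p q f g) (a : P.obj X) :
    P.pull g (P.push f a) = P.push q (P.pull p a) := by
  have h := P.map_comp (Relation.graph f) (Relation.cograph g)
  rw [Relation.graph_comp_cograph sq, P.map_comp] at h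
  exact (DFunLike.congr_fun h a).symm

theorem push_lax {X Y X' Y' : C} (f : X ⟶ Y) (g : X' ⟶ Y') (a : P.obj X) (b : P.obj X') :
    P.push (f ⊗ₘ g) (P.lax _ _ (a, b)) = P.lax _ _ (P.push f a, P.push g b) := by
  rw [push, ← Relation.tensor_graph, P.lax_natural]; rfl

theorem pull_lax {X Y X' Y' : C} (f : X ⟶ Y) (g : X' ⟶ Y') (a : P.obj Y) (b : P.obj Y') :
    P.pull (f ⊗ₘ g) (P.lax _ _ (a, b)) = P.lax _ _ (P.pull f a, P.pull g b) := by
  rw [pull, ← Relation.tensor_cograph, P.lax_natural]; rfl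

theorem le_unit (a : P.obj (𝟙_ C)) : a ≤ P.unit := by
  obtain ⟨l, hl⟩ := P.unit_adj
  exact (hl a PUnit.unit).1 le_rfl

theorem pull_rightUnitor {X : C} (a : P.obj X) :
    P.pull (ρ_ X).hom a = P.lax _ _ (a, P.unit) := by
  conv_lhs => rw [← P.lax_right_unit X a]
  change P.pull _ (P.push _ _) = _
  rw [P.pull_push (IsPullback.of_vert_isIso (fst := 𝟙 _) (snd := 𝟙 _) ⟨by simp⟩), pull_id,
    push_id]

theorem pull_leftUnitor {X : C} (a : P.obj X) :
    P.pull (λ_ X).hom a = P.lax _ _ (P.unit, a) := by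
  conv_lhs => rw [← P.lax_left_unit X a]
  change P.pull _ (P.push _ _) = _
  rw [P.pull_push (IsPullback.of_vert_isIso (fst := 𝟙 _) (snd := 𝟙 _) ⟨by simp⟩), pull_id,
    push_id]

/-- The top element `true` of `P(X)`. -/
noncomputable instance (X : C) : OrderTop (P.obj X) where
  top := P.pull (toUnit X) P.unit
  le_top _ := (P.gc _ _ _).1 (P.le_unit _)

theorem pull_fst {X Y : C} (a : P.obj X) : P.pull (fst X Y) a = P.lax X Y (a, ⊤) := by
  have h := P.pull_lax (𝟙 X) (toUnit Y) a P.unit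
  rw [← pull_rightUnitor, pull_pull, pull_id] at h
  change _ = P.lax X Y (a, P.pull (toUnit Y) P.unit)
  rw [← h]
  congr 2
  simp [fst_def, toUnit]

theorem pull_snd {X Y : C} (b : P.obj Y) : P.pull (snd X Y) b = P.lax X Y (⊤, b) := by
  have h := P.pull_lax (toUnit X) (𝟙 Y) P.unit b
  rw [← pull_leftUnitor, pull_pull, pull_id] at h
  change _ = P.lax X Y (P.pull (toUnit X) P.unit, b)
  rw [← h]
  congr 2
  simp [snd_def, toUnit]

theorem le_lax_iff {X Y : C} (a : P.obj X) (b : P.obj Y) (c : P.obj (X ⊗ Y)) :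
    c ≤ P.lax X Y (a, b) ↔ c ≤ P.pull (fst X Y) a ∧ c ≤ P.pull (snd X Y) b := by
  obtain ⟨l, hl⟩ := P.lax_adj X Y
  rw [pull_fst, pull_snd, ← hl, ← hl, ← hl]
  simp [Prod.le_def]

/-- The meet of two elements of `P(X)` is the pullback of their exterior conjunction along the
diagonal. -/
noncomputable instance (X : C) : SemilatticeInf (P.obj X) :=
  { (inferInstance : PartialOrder (P.obj X)) with
    inf := fun a b => P.pull (lift (𝟙 X) (𝟙 X)) (P.lax X X (a, b))
    inf_le_left := fun a b => by
      have h := (P.pull (lift (𝟙 X) (𝟙 X))).monotone ((P.le_lax_iff a b _).1 le_rfl).1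
      rwa [pull_pull, lift_fst, pull_id] at h
    inf_le_right := fun a b => by
      have h := (P.pull (lift (𝟙 X) (𝟙 X))).monotone ((P.le_lax_iff a b _).1 le_rfl).2
      rwa [pull_pull, lift_snd, pull_id] at h
    le_inf := fun a b c h h' => by
      change a ≤ P.pull _ _
      rw [← P.gc _ _ _, le_lax_iff, P.gc _ _ _, P.gc _ _ _, pull_pull, pull_pull, lift_fst,
        lift_snd, pull_id, pull_id]
      exact ⟨h, h'⟩ }

theorem inf_def {X : C} (a b : P.obj X) :
    a ⊓ b = P.pull (lift (𝟙 X) (𝟙 X)) (P.lax X X (a, b)) := rfl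

theorem lax_eq {X Y : C} (a : P.obj X) (b : P.obj Y) :
    P.lax X Y (a, b) = P.pull (fst X Y) a ⊓ P.pull (snd X Y) b :=
  eq_of_forall_le_iff fun c => by rw [le_lax_iff, le_inf_iff]

theorem pull_inf {X Y : C} (f : X ⟶ Y) (a b : P.obj Y) :
    P.pull f (a ⊓ b) = P.pull f a ⊓ P.pull f b := (P.gc f).u_inf

/-- Frobenius reciprocity. -/
theorem push_inf_pull {X Y : C} (f : X ⟶ Y) (a : P.obj X) (b : P.obj Y) :
    P.push f (a ⊓ P.pull f b) = P.push f a ⊓ b := by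
  have sq : IsPullback (lift (𝟙 X) f) f (f ⊗ₘ 𝟙 Y) (lift (𝟙 Y) (𝟙 Y)) :=
    isPullback_of (by simp)
      (fun a b h => ⟨a ≫ fst _ _, by
        have h₁ := h =≫ fst _ _
        have h₂ := h =≫ snd _ _
        simp at h₁ h₂
        constructor
        · ext <;> simp [h₁, h₂]
        · simp [h₁]⟩)
      (fun l l' h _ => by simpa using h =≫ fst _ _)
  have h := P.push_lax f (𝟙 Y) a b
  rw [push_id] at h
  rw [inf_def P (P.push f a), ← h, P.pull_push sq, lax_eq, pull_inf, pull_pull, pull_pull]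
  simp [pull_id]

/-! ## Internal relations -/

/-- The wiring diagram `(X ⊗ Y) ⊗ (Y ⊗ Z) ⇸ X ⊗ Z` which connects the two copies of `Y`. -/
noncomputable def compWire (X Y Z : C) : Relation ((X ⊗ Y) ⊗ (Y ⊗ Z)) (X ⊗ Z) :=
  Relation.ofSpan (A := X ⊗ (Y ⊗ Z))
    (lift (lift (fst _ _) (snd _ _ ≫ fst _ _)) (lift (snd _ _ ≫ fst _ _) (snd _ _ ≫ snd _ _)))
    (lift (fst _ _) (snd _ _ ≫ snd _ _))

/-- The composite `θ ⨟ θ'` of `θ ∈ P(X ⊗ Y)` and `θ' ∈ P(Y ⊗ Z)`. -/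
noncomputable def relComp {X Y Z : C} (θ : P.obj (X ⊗ Y)) (θ' : P.obj (Y ⊗ Z)) :
    P.obj (X ⊗ Z) :=
  P.map (compWire X Y Z) (P.lax _ _ (θ, θ'))

/-- The identity relation `δ_!(φ)` on `φ ∈ P(X)`. -/
noncomputable def relId {X : C} (φ : P.obj X) : P.obj (X ⊗ X) := P.push (lift (𝟙 X) (𝟙 X)) φ

/-- The transpose of `θ ∈ P(X ⊗ Y)`. -/
noncomputable def transpose {X Y : C} (θ : P.obj (X ⊗ Y)) : P.obj (Y ⊗ X) :=
  P.push (lift (snd X Y) (fst X Y)) θ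

theorem relComp_eq {X Y Z : C} (θ : P.obj (X ⊗ Y)) (θ' : P.obj (Y ⊗ Z)) :
    P.relComp θ θ' = P.push (lift (fst X (Y ⊗ Z)) (snd _ _ ≫ snd _ _))
      (P.pull (lift (fst _ _) (snd _ _ ≫ fst _ _)) θ ⊓ P.pull (snd _ _) θ') := by
  rw [relComp, compWire, map_ofSpan, lax_eq, pull_inf, pull_pull, pull_pull]
  simp

theorem relComp_mono {X Y Z : C} {θ₁ θ₂ : P.obj (X ⊗ Y)} {θ₁' θ₂' : P.obj (Y ⊗ Z)}
    (h : θ₁ ≤ θ₂) (h' : θ₁' ≤ θ₂') : P.relComp θ₁ θ₁' ≤ P.relComp θ₂ θ₂' :=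
  (P.map _).monotone ((P.lax _ _).monotone ⟨h, h'⟩)

theorem relComp_assoc {W X Y Z : C} (θ₁ : P.obj (W ⊗ X)) (θ₂ : P.obj (X ⊗ Y))
    (θ₃ : P.obj (Y ⊗ Z)) :
    P.relComp (P.relComp θ₁ θ₂) θ₃ = P.relComp θ₁ (P.relComp θ₂ θ₃) := by
  have sq₁ : IsPullback
      (lift (fst W (X ⊗ (Y ⊗ Z))) (lift (snd _ _ ≫ fst _ _) (snd _ _ ≫ snd _ _ ≫ fst _ _)))
      (lift (fst W (X ⊗ (Y ⊗ Z))) (snd _ _ ≫ snd _ _))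
      (lift (fst W (X ⊗ Y)) (snd _ _ ≫ snd _ _))
      (lift (fst W (Y ⊗ Z)) (snd _ _ ≫ fst _ _)) :=
    isPullback_of (by simp)
      (fun a b h => ⟨lift (a ≫ fst _ _) (lift (a ≫ snd _ _ ≫ fst _ _) (b ≫ snd _ _)), by
        have h₁ := h =≫ fst _ _
        have h₂ := h =≫ snd _ _
        simp at h₁ h₂
        constructor
        · ext <;> simp [h₂]
        · ext <;> simp [h₁]⟩)
      (fun l l' h h' => by
        have h₁ := h =≫ fst _ _
        have h₂ := (h =≫ snd _ _) =≫ fst _ _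
        have h₃ := h' =≫ snd _ _
        simp at h₁ h₂ h₃
        ext
        · exact h₁
        · simpa using h₂
        · simpa using (h₃ =≫ fst _ _)
        · simpa using (h₃ =≫ snd _ _))
  have sq₂ : IsPullback
      (snd W (X ⊗ (Y ⊗ Z)))
      (lift (fst W (X ⊗ (Y ⊗ Z))) (lift (snd _ _ ≫ fst _ _) (snd _ _ ≫ snd _ _ ≫ snd _ _)))
      (lift (fst X (Y ⊗ Z)) (snd _ _ ≫ snd _ _))
      (snd W (X ⊗ Z)) :=
    isPullback_of (by simp)
      (fun a b h => ⟨lift (b ≫ fst _ _) a, by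
        have h₁ := h =≫ fst _ _
        have h₂ := h =≫ snd _ _
        simp at h₁ h₂
        constructor
        · ext <;> simp
        · ext <;> simp [h₁, h₂]⟩)
      (fun l l' h h' => by
        have h₁ := h' =≫ fst _ _
        simp at h₁
        exact CartesianMonoidalCategory.hom_ext _ _ h₁ h)
  rw [relComp_eq, relComp_eq, P.pull_push sq₁, ← push_inf_pull, push_push,
    relComp_eq, relComp_eq, P.pull_push sq₂, inf_comm _ (P.push _ _), ← push_inf_pull, push_push]
  simp only [pull_inf, pull_pull]
  simp
  rw [inf_assoc, inf_comm]

theorem relId_comp {X Y : C} {φ : P.obj X} {θ : P.obj (X ⊗ Y)} (h : P.push (fst X Y) θ ≤ φ) :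
    P.relComp (P.relId φ) θ = θ := by
  have sq : IsPullback (fst X Y) (lift (fst X Y) (𝟙 _)) (lift (𝟙 X) (𝟙 X))
      (lift (fst X (X ⊗ Y)) (snd _ _ ≫ fst _ _)) :=
    isPullback_of (by simp)
      (fun a b h => ⟨b ≫ snd _ _, by
        have h₁ := h =≫ fst _ _
        have h₂ := h =≫ snd _ _
        simp at h₁ h₂
        constructor
        · simp [h₂]
        · ext <;> simp [← h₁, h₂]⟩)
      (fun l l' _ h => by simpa using h =≫ snd _ _)
  rw [relComp_eq, relId, P.pull_push sq, ← push_inf_pull, push_push, pull_pull]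
  simpa [push_id, pull_id] using (P.gc _ _ _).1 h

theorem relComp_id {X Y : C} {φ : P.obj Y} {θ : P.obj (X ⊗ Y)} (h : P.push (snd X Y) θ ≤ φ) :
    P.relComp θ (P.relId φ) = θ := by
  have sq : IsPullback (snd X Y) (lift (fst X Y) (lift (snd X Y) (snd X Y))) (lift (𝟙 Y) (𝟙 Y))
      (snd X (Y ⊗ Y)) :=
    isPullback_of (by simp)
      (fun a b h => ⟨lift (b ≫ fst _ _) a, by
        constructor
        · simp
        · ext <;> simp [← h]⟩)
      (fun l l' h h' => CartesianMonoidalCategory.hom_ext _ _ (by simpa using h' =≫ fst _ _) h)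
  rw [relComp_eq, relId, P.pull_push sq, inf_comm, ← push_inf_pull, push_push, pull_pull]
  simpa [push_id, pull_id] using (P.gc _ _ _).1 h

theorem push_fst_relComp_le {X Y Z : C} (θ : P.obj (X ⊗ Y)) (θ' : P.obj (Y ⊗ Z)) :
    P.push (fst X Z) (P.relComp θ θ') ≤ P.push (fst X Y) θ := by
  rw [relComp_eq, push_push, P.gc _ _ _]
  refine inf_le_left.trans ?_
  have h := (P.pull (lift (fst X (Y ⊗ Z)) (snd _ _ ≫ fst _ _))).monotone
    ((P.gc (fst X Y)).le_u_l θ)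
  rw [pull_pull] at h
  simpa using h

theorem push_snd_relComp_le {X Y Z : C} (θ : P.obj (X ⊗ Y)) (θ' : P.obj (Y ⊗ Z)) :
    P.push (snd X Z) (P.relComp θ θ') ≤ P.push (snd Y Z) θ' := by
  rw [relComp_eq, push_push, P.gc _ _ _]
  refine inf_le_right.trans ?_
  have h := (P.pull (snd X (Y ⊗ Z))).monotone ((P.gc (snd Y Z)).le_u_l θ')
  rw [pull_pull] at h
  simpa using h

end AjaxFunctor

end Relations

/-- A po-category: a category whose hom-sets are partially ordered, with monotone composition. -/
class PoCategory (D : Type u) extends Category.{v} D where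
  /-- the order on the hom-sets -/
  homOrder : ∀ X Y : D, PartialOrder (X ⟶ Y)
  comp_le_comp : ∀ {X Y Z : D} {f f' : X ⟶ Y} {g g' : Y ⟶ Z}, f ≤ f' → g ≤ g' →
    f ≫ g ≤ f' ≫ g'

namespace PoCategory

attribute [reducible, instance] homOrder

/-- The left adjoints in a po-category. -/
def leftAdjoints (D : Type u) [PoCategory.{v} D] : MorphismProperty D := fun X Y f =>
  ∃ g : Y ⟶ X, 𝟙 X ≤ f ≫ g ∧ g ≫ f ≤ 𝟙 Y

instance (D : Type u) [PoCategory.{v} D] : (leftAdjoints D).IsMultiplicative where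
  id_mem X := ⟨𝟙 X, by simp, by simp⟩
  comp_mem := by
    rintro X Y Z f f' ⟨g, h₁, h₂⟩ ⟨g', h₁', h₂'⟩
    refine ⟨g' ≫ g, h₁.trans ?_, le_trans ?_ h₂'⟩
    · simpa using comp_le_comp (le_refl f) (comp_le_comp h₁' (le_refl g))
    · simpa using comp_le_comp (le_refl g') (comp_le_comp h₂ (le_refl f'))

/-- The category `LAdj(D)` with the same objects as the po-category `D` and with the left adjoints
as morphisms. -/
abbrev LAdj (D : Type u) [PoCategory.{v} D] := WideSubcategory (leftAdjoints D)

end PoCategory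

section InternalRelations

variable {C : Type u} [Category.{v} C] [CartesianMonoidalCategory C] [HasPullbacks C] [HasImages C]

/-- The objects `(Γ, φ)` of the po-category of internal relations: an object `Γ` together with a
predicate `φ ∈ P(Γ)`. -/
structure IntRel (P : AjaxFunctor.{w} C) where
  /-- the context -/
  ctx : C
  /-- the predicate in that context -/
  pred : P.obj ctx

namespace IntRel

variable {P : AjaxFunctor.{w} C}

/-- An internal relation `(Γ₁, φ₁) ⟶ (Γ₂, φ₂)`: an element `θ ∈ P(Γ₁ ⊗ Γ₂)` with
`(π₁)_! θ ⊢ φ₁` and `(π₂)_! θ ⊢ φ₂`. -/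
@[ext]
structure Hom (X Y : IntRel P) where
  /-- the underlying element of `P(Γ₁ ⊗ Γ₂)` -/
  rel : P.obj (X.ctx ⊗ Y.ctx)
  push_fst_le : P.push (fst _ _) rel ≤ X.pred
  push_snd_le : P.push (snd _ _) rel ≤ Y.pred

/-- The po-category of internal relations, ordered by entailment. -/
noncomputable instance : PoCategory (IntRel P) where
  Hom := Hom
  id X := ⟨P.relId X.pred, by simp [AjaxFunctor.relId, AjaxFunctor.push_push, AjaxFunctor.push_id],
    by simp [AjaxFunctor.relId, AjaxFunctor.push_push, AjaxFunctor.push_id]⟩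
  comp f g := ⟨P.relComp f.rel g.rel, (P.push_fst_relComp_le _ _).trans f.push_fst_le,
    (P.push_snd_relComp_le _ _).trans g.push_snd_le⟩
  id_comp f := Hom.ext (P.relId_comp f.push_fst_le)
  comp_id f := Hom.ext (P.relComp_id f.push_snd_le)
  assoc f g h := Hom.ext (P.relComp_assoc f.rel g.rel h.rel)
  homOrder X Y := PartialOrder.lift Hom.rel fun _ _ => Hom.ext
  comp_le_comp h h' := P.relComp_mono h h'

end IntRel

/-- The category `R_P` of internal functions: the left adjoints in the po-category of internal
relations. -/
abbrev InternalFunctions (P : AjaxFunctor.{w} C) := PoCategory.LAdj (IntRel P)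

namespace InternalFunctions

variable {P : AjaxFunctor.{w} C}

/-- The object `(Γ, φ)` of `R_P`. -/
abbrev of (Γ : C) (φ : P.obj Γ) : InternalFunctions P := ⟨⟨Γ, φ⟩⟩

/-- The context `Γ` of an object `(Γ, φ)` of `R_P`. -/
abbrev ctx (A : InternalFunctions P) : C := A.obj.ctx

/-- The element of `P(Γ₁ ⊗ Γ₂)` underlying an internal function `(Γ₁, φ₁) ⟶ (Γ₂, φ₂)`. -/
abbrev rel {A B : InternalFunctions P} (f : A ⟶ B) : P.obj (ctx A ⊗ ctx B) := f.hom.rel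

/-- The image `im(θ) ∈ P(Γ₂)` of an internal function `θ : (Γ₁, φ₁) ⟶ (Γ₂, φ₂)`. -/
noncomputable def im {A B : InternalFunctions P} (f : A ⟶ B) : P.obj (ctx B) :=
  P.push (snd _ _) (rel f)

end InternalFunctions

end InternalRelations

/-! ## Allegories -/

/-! The calculus `P` interprets regular logic: pulling back is substitution, pushing forward is
existential quantification, and Beck–Chevalley and Frobenius make the two interact as they do for
sets. Internal relations therefore obey the algebra of ordinary relations, and regularity is a
consequence of that algebra alone.

The abstract half works in an allegory, where the modular law is the only nontrivial axiom. Its main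
consequence is `id_le_meet_comp_meet`: a relation of the form 1 ≤ r s survives cutting r and s down
to their mutually reciprocal parts. Hence the right adjoint of f can only be f† (`eq_dagger`), so
left adjoints are exactly the total and single-valued morphisms, and comparable ones are equal. A
tabulation of f g† is a pullback of f and g; a surjective left adjoint is the coequalizer of a
tabulation of its kernel; surjectivity is stable under pullback. If tabulations and images exist,
the regular epimorphisms are exactly the surjective left adjoints, and `IsTabular.regular` follows.

The concrete half verifies the hypotheses for internal relations. The modular law is Frobenius
reciprocity (`relComp_inf_le`). A relation r is tabulated by the two projections out of its own
context with predicate r (`InternalFunctions.isTabulation`), and an image is obtained by shrinking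
the predicate of the codomain. The explicit formulas are read off from these choices. Of the
contexts, only the cartesian structure, pullbacks and images are used. -/

/-- An allegory structure on a po-category: binary meets of parallel morphisms and an
order-preserving involution that satisfy the modular law. -/
class Allegory (D : Type u) [PoCategory.{v} D] where
  /-- the reciprocal of a morphism -/
  dagger : ∀ {X Y : D}, (X ⟶ Y) → (Y ⟶ X)
  dagger_dagger : ∀ {X Y : D} (f : X ⟶ Y), dagger (dagger f) = f
  dagger_mono : ∀ {X Y : D} {f g : X ⟶ Y}, f ≤ g → dagger f ≤ dagger g
  dagger_comp : ∀ {X Y Z : D} (f : X ⟶ Y) (g : Y ⟶ Z), dagger (f ≫ g) = dagger g ≫ dagger f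
  /-- the meet of two parallel morphisms -/
  meet : ∀ {X Y : D}, (X ⟶ Y) → (X ⟶ Y) → (X ⟶ Y)
  meet_le_left : ∀ {X Y : D} (f g : X ⟶ Y), meet f g ≤ f
  meet_le_right : ∀ {X Y : D} (f g : X ⟶ Y), meet f g ≤ g
  le_meet : ∀ {X Y : D} {f g h : X ⟶ Y}, f ≤ g → f ≤ h → f ≤ meet g h
  modular : ∀ {X Y Z : D} (r : X ⟶ Y) (s : Y ⟶ Z) (t : X ⟶ Z),
    meet (r ≫ s) t ≤ meet r (t ≫ dagger s) ≫ s

namespace Allegory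

open PoCategory

local postfix:max "†" => Allegory.dagger

variable {D : Type u} [PoCategory.{v} D]

@[gcongr]
theorem comp_mono {X Y Z : D} {f f' : X ⟶ Y} {g g' : Y ⟶ Z} (h : f ≤ f') (h' : g ≤ g') :
    f ≫ g ≤ f' ≫ g' := comp_le_comp h h'

theorem le_comp_of_id_le {X Y : D} {r : X ⟶ X} (h : 𝟙 X ≤ r) (f : X ⟶ Y) : f ≤ r ≫ f := by
  simpa using comp_le_comp h (le_refl f)

theorem le_comp_of_le_id {X Y : D} {r : Y ⟶ Y} (h : 𝟙 Y ≤ r) (f : X ⟶ Y) : f ≤ f ≫ r := by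
  simpa using comp_le_comp (le_refl f) h

theorem comp_le_of_le_id {X Y : D} {r : X ⟶ X} (h : r ≤ 𝟙 X) (f : X ⟶ Y) : r ≫ f ≤ f := by
  simpa using comp_le_comp h (le_refl f)

theorem comp_le_of_id_le {X Y : D} {r : Y ⟶ Y} (h : r ≤ 𝟙 Y) (f : X ⟶ Y) : f ≫ r ≤ f := by
  simpa using comp_le_comp (le_refl f) h

variable [Allegory D]

/-! ### Adjoints and reciprocals -/

theorem dagger_id (X : D) : (𝟙 X)† = 𝟙 X := by
  simpa [dagger_dagger] using (dagger_comp (𝟙 X)† (𝟙 X)).symm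

theorem dagger_le_iff {X Y : D} {f : X ⟶ Y} {g : Y ⟶ X} : f† ≤ g ↔ f ≤ g† :=
  ⟨fun h => by simpa [dagger_dagger] using dagger_mono h,
    fun h => by simpa [dagger_dagger] using dagger_mono h⟩

/-- If the identity lies below a composite, it lies below the composite of the largest mutually
reciprocal parts of the two factors. -/
theorem id_le_meet_comp_meet {X Y : D} {r : X ⟶ Y} {s : Y ⟶ X} (h : 𝟙 X ≤ r ≫ s) :
    𝟙 X ≤ meet r s† ≫ meet s r† := by
  -- The modular law with t = 1 cuts r down to r ∧ s†. Taking reciprocals and applying it once more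
  -- does the same for the other factor.
  have h₁ : 𝟙 X ≤ meet r s† ≫ s := by
    simpa using (le_meet h le_rfl).trans (modular r s (𝟙 X))
  have h₂ : 𝟙 X ≤ s† ≫ (meet r s†)† := by
    simpa [dagger_comp, dagger_id] using dagger_mono h₁
  have h₃ := (le_meet h₂ le_rfl).trans (modular _ _ (𝟙 X))
  rw [dagger_dagger, Category.id_comp] at h₃
  have h₄ := dagger_mono h₃
  rw [dagger_id, dagger_comp, dagger_dagger] at h₄
  refine h₄.trans (comp_mono le_rfl (le_meet ?_ ?_))
  · exact dagger_le_iff.2 (meet_le_left _ _)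
  · exact dagger_mono ((meet_le_right _ _).trans (meet_le_left _ _))

/-- The right adjoint of a morphism is its reciprocal. -/
theorem eq_dagger {X Y : D} {f : X ⟶ Y} {g : Y ⟶ X} (h : 𝟙 X ≤ f ≫ g) (h' : g ≫ f ≤ 𝟙 Y) :
    g = f† := by
  -- With the unit sharpened to 1 ≤ (f ∧ g†)(g ∧ f†), the counit g f ≤ 1 absorbs everything except
  -- one of the two meets.
  have hk := id_le_meet_comp_meet h
  have h₁ : f ≤ g† :=
    calc f ≤ (meet f g† ≫ meet g f†) ≫ f := le_comp_of_id_le hk f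
      _ ≤ (meet f g† ≫ g) ≫ f := by gcongr; exact meet_le_left _ _
      _ = meet f g† ≫ (g ≫ f) := Category.assoc _ _ _
      _ ≤ meet f g† := comp_le_of_id_le h' _
      _ ≤ g† := meet_le_right _ _
  have h₂ : g ≤ f† :=
    calc g ≤ g ≫ (meet f g† ≫ meet g f†) := le_comp_of_le_id hk g
      _ ≤ g ≫ (f ≫ meet g f†) := by gcongr; exact meet_le_left _ _
      _ = (g ≫ f) ≫ meet g f† := (Category.assoc _ _ _).symm
      _ ≤ meet g f† := comp_le_of_le_id h' _
      _ ≤ f† := meet_le_right _ _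
  exact le_antisymm h₂ (dagger_le_iff.2 h₁)

theorem leftAdjoints_iff {X Y : D} {f : X ⟶ Y} :
    leftAdjoints D f ↔ 𝟙 X ≤ f ≫ f† ∧ f† ≫ f ≤ 𝟙 Y := by
  refine ⟨?_, fun h => ⟨_, h⟩⟩
  rintro ⟨g, h, h'⟩
  obtain rfl := eq_dagger h h'
  exact ⟨h, h'⟩

theorem id_le_comp_dagger {X Y : LAdj D} (f : X ⟶ Y) : 𝟙 X.obj ≤ f.hom ≫ f.hom† :=
  (leftAdjoints_iff.1 f.property).1

theorem dagger_comp_le_id {X Y : LAdj D} (f : X ⟶ Y) : f.hom† ≫ f.hom ≤ 𝟙 Y.obj :=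
  (leftAdjoints_iff.1 f.property).2

/-- Comparable left adjoints are equal. -/
theorem eq_of_hom_le {X Y : LAdj D} {f g : X ⟶ Y} (h : f.hom ≤ g.hom) : f = g := by
  refine WideSubcategory.hom_ext _ (le_antisymm h ?_)
  calc g.hom ≤ (f.hom ≫ f.hom†) ≫ g.hom := le_comp_of_id_le (id_le_comp_dagger f) _
    _ = f.hom ≫ (f.hom† ≫ g.hom) := Category.assoc _ _ _
    _ ≤ f.hom ≫ (g.hom† ≫ g.hom) := by gcongr; exact dagger_mono h
    _ ≤ f.hom := comp_le_of_id_le (dagger_comp_le_id g) _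

/-- Totality of f turns the hypothesis into g ≤ f. This is the form in which uniqueness is checked
for tabulations and for the terminal object. -/
theorem eq_of_dagger_comp_le {X Y : LAdj D} {f g : X ⟶ Y} (h : f.hom† ≫ g.hom ≤ 𝟙 Y.obj) :
    g = f := by
  refine eq_of_hom_le ?_
  calc g.hom ≤ (f.hom ≫ f.hom†) ≫ g.hom := le_comp_of_id_le (id_le_comp_dagger f) _
    _ = f.hom ≫ (f.hom† ≫ g.hom) := Category.assoc _ _ _
    _ ≤ f.hom := comp_le_of_id_le h _

/-! ### Tabulations and pullbacks -/

/-- The two left adjoints `p` and `q` tabulate the morphism `r`. -/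
structure IsTabulation {X Y Z : LAdj D} (r : X.obj ⟶ Y.obj) (p : Z ⟶ X) (q : Z ⟶ Y) : Prop where
  dagger_comp_eq : p.hom† ≫ q.hom = r
  meet_le : meet (p.hom ≫ p.hom†) (q.hom ≫ q.hom†) ≤ 𝟙 Z.obj

/-- The lift relates w to every z with p z = a w and q z = b w. Such a z exists because the pair (a
w, b w) lies in r = p† q, and it is unique because p and q are jointly monic. -/
theorem IsTabulation.exists_lift {W X Y Z : LAdj D} {r : X.obj ⟶ Y.obj} {p : Z ⟶ X} {q : Z ⟶ Y}
    (h : IsTabulation r p q) (a : W ⟶ X) (b : W ⟶ Y) (hab : a.hom† ≫ b.hom ≤ r) :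
    ∃ l : W ⟶ Z, l ≫ p = a ∧ l ≫ q = b := by
  have hl : leftAdjoints D (meet (a.hom ≫ p.hom†) (b.hom ≫ q.hom†)) := by
    rw [leftAdjoints_iff]
    constructor
    · have h₁ : 𝟙 W.obj ≤ (a.hom ≫ p.hom†) ≫ (q.hom ≫ b.hom†) :=
        calc 𝟙 W.obj ≤ a.hom ≫ a.hom† := id_le_comp_dagger a
          _ ≤ a.hom ≫ (a.hom† ≫ (b.hom ≫ b.hom†)) := by
            gcongr; exact le_comp_of_le_id (id_le_comp_dagger b) _
          _ = a.hom ≫ ((a.hom† ≫ b.hom) ≫ b.hom†) := by simp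
          _ ≤ a.hom ≫ ((p.hom† ≫ q.hom) ≫ b.hom†) := by rw [h.dagger_comp_eq]; gcongr
          _ = _ := by simp
      -- The second factor produced here is the reciprocal of the first, so the bound is totality of
      -- the lift.
      have h₂ := id_le_meet_comp_meet h₁
      simp only [dagger_comp, dagger_dagger] at h₂
      refine h₂.trans (comp_mono le_rfl (dagger_le_iff.1 (le_meet ?_ ?_)))
      · simpa [dagger_comp, dagger_dagger] using
          dagger_mono (meet_le_right (q.hom ≫ b.hom†) (p.hom ≫ a.hom†))
      · simpa [dagger_comp, dagger_dagger] using
          dagger_mono (meet_le_left (q.hom ≫ b.hom†) (p.hom ≫ a.hom†))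
    · have key : ∀ {V : LAdj D} (c : W ⟶ V) (s : Z ⟶ V) {m : W.obj ⟶ Z.obj},
          m ≤ c.hom ≫ s.hom† → m† ≫ m ≤ s.hom ≫ s.hom† := fun {_} c s {_} hm =>
        calc _ ≤ (c.hom ≫ s.hom†)† ≫ (c.hom ≫ s.hom†) := comp_mono (dagger_mono hm) hm
          _ = s.hom ≫ ((c.hom† ≫ c.hom) ≫ s.hom†) := by simp [dagger_comp, dagger_dagger]
          _ ≤ s.hom ≫ s.hom† := by gcongr; exact comp_le_of_le_id (dagger_comp_le_id c) _
      exact (le_meet (key a p (meet_le_left _ _)) (key b q (meet_le_right _ _))).trans h.meet_le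
  have key : ∀ {V : LAdj D} (c : W ⟶ V) (s : Z ⟶ V) {m : W.obj ⟶ Z.obj},
      m ≤ c.hom ≫ s.hom† → m ≫ s.hom ≤ c.hom := fun {_} c s {_} hm =>
    calc _ ≤ (c.hom ≫ s.hom†) ≫ s.hom := comp_mono hm le_rfl
      _ = c.hom ≫ (s.hom† ≫ s.hom) := Category.assoc _ _ _
      _ ≤ c.hom := comp_le_of_id_le (dagger_comp_le_id s) _
  exact ⟨⟨_, hl⟩, eq_of_hom_le (key a p (meet_le_left _ _)),
    eq_of_hom_le (key b q (meet_le_right _ _))⟩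

/-- Agreement after s bounds l'† l by s s†. Doing this for both legs bounds it by the meet, hence by
the identity. -/
theorem IsTabulation.hom_ext {W X Y Z : LAdj D} {r : X.obj ⟶ Y.obj} {p : Z ⟶ X} {q : Z ⟶ Y}
    (h : IsTabulation r p q) {l l' : W ⟶ Z} (hp : l ≫ p = l' ≫ p) (hq : l ≫ q = l' ≫ q) :
    l = l' := by
  have key : ∀ {V : LAdj D} (s : Z ⟶ V), l ≫ s = l' ≫ s →
      l'.hom† ≫ l.hom ≤ s.hom ≫ s.hom† := fun s hs =>
    calc l'.hom† ≫ l.hom ≤ l'.hom† ≫ (l.hom ≫ (s.hom ≫ s.hom†)) := by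
          gcongr; exact le_comp_of_le_id (id_le_comp_dagger s) _
      _ = l'.hom† ≫ ((l ≫ s).hom ≫ s.hom†) := by simp
      _ = (l'.hom† ≫ l'.hom) ≫ (s.hom ≫ s.hom†) := by rw [hs]; simp
      _ ≤ s.hom ≫ s.hom† := comp_le_of_le_id (dagger_comp_le_id l') _
  exact eq_of_dagger_comp_le ((le_meet (key p hp) (key q hq)).trans h.meet_le)

/-- A tabulation of `f ≫ g†` is a pullback of `f` and `g`. -/
theorem IsTabulation.isPullback {X Y Z W : LAdj D} {f : X ⟶ W} {g : Y ⟶ W} {p : Z ⟶ X} {q : Z ⟶ Y}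
    (h : IsTabulation (f.hom ≫ g.hom†) p q) : IsPullback p q f g := by
  have w : p ≫ f = q ≫ g := by
    refine (eq_of_hom_le ?_).symm
    calc q.hom ≫ g.hom ≤ (p.hom ≫ p.hom†) ≫ (q.hom ≫ g.hom) :=
          le_comp_of_id_le (id_le_comp_dagger p) _
      _ = p.hom ≫ ((p.hom† ≫ q.hom) ≫ g.hom) := by simp
      _ = (p.hom ≫ f.hom) ≫ (g.hom† ≫ g.hom) := by rw [h.dagger_comp_eq]; simp
      _ ≤ p.hom ≫ f.hom := comp_le_of_id_le (dagger_comp_le_id g) _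
  -- Every cone over f and g satisfies the hypothesis of `exists_lift`.
  have h_le : ∀ {V : LAdj D} {a : V ⟶ X} {b : V ⟶ Y}, a ≫ f = b ≫ g →
      a.hom† ≫ b.hom ≤ f.hom ≫ g.hom† := fun {_ a b} hab =>
    calc a.hom† ≫ b.hom ≤ (a.hom† ≫ b.hom) ≫ (g.hom ≫ g.hom†) :=
          le_comp_of_le_id (id_le_comp_dagger g) _
      _ = a.hom† ≫ ((b ≫ g).hom ≫ g.hom†) := by simp
      _ = (a.hom† ≫ a.hom) ≫ (f.hom ≫ g.hom†) := by rw [← hab]; simp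
      _ ≤ f.hom ≫ g.hom† := comp_le_of_le_id (dagger_comp_le_id a) _
  have hl : ∀ s : PullbackCone f g, ∃ l, l ≫ p = s.fst ∧ l ≫ q = s.snd :=
    fun s => h.exists_lift s.fst s.snd (h_le s.condition)
  refine ⟨⟨w⟩, ⟨PullbackCone.IsLimit.mk w (fun s => (hl s).choose)
    (fun s => (hl s).choose_spec.1) (fun s => (hl s).choose_spec.2) (fun s m h₁ h₂ => ?_)⟩⟩
  exact h.hom_ext (h₁.trans (hl s).choose_spec.1.symm) (h₂.trans (hl s).choose_spec.2.symm)

/-! ### Monomorphisms and surjective left adjoints -/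

theorem mono_of_comp_dagger_le {X Y : LAdj D} {m : X ⟶ Y} (h : m.hom ≫ m.hom† ≤ 𝟙 X.obj) :
    Mono m := by
  refine ⟨fun a b hab => eq_of_hom_le ?_⟩
  calc a.hom ≤ a.hom ≫ (m.hom ≫ m.hom†) := le_comp_of_le_id (id_le_comp_dagger m) _
    _ = (a ≫ m).hom ≫ m.hom† := by simp
    _ = b.hom ≫ (m.hom ≫ m.hom†) := by rw [hab]; simp
    _ ≤ b.hom := comp_le_of_id_le h _

/-- A surjective left adjoint is the coequalizer of every tabulation of its kernel. -/
theorem isRegularEpi_of_id_le {X Y Z : LAdj D} {e : X ⟶ Y} {p q : Z ⟶ X}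
    (h : IsTabulation (e.hom ≫ e.hom†) p q) (he : 𝟙 Y.obj ≤ e.hom† ≫ e.hom) :
    IsRegularEpi e := by
  -- The factorization of k is e† k. Surjectivity of e makes it total; e e† = p† q together with p k
  -- = q k gives e e† k ≤ k, which makes it single-valued.
  have hdesc : ∀ {V : LAdj D} (k : X ⟶ V), p ≫ k = q ≫ k → ∃ l : Y ⟶ V, e ≫ l = k := by
    intro V k hk
    have h₁ : e.hom ≫ (e.hom† ≫ k.hom) ≤ k.hom :=
      calc e.hom ≫ (e.hom† ≫ k.hom) = p.hom† ≫ (q ≫ k).hom := by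
            rw [← Category.assoc, ← h.dagger_comp_eq]; simp
        _ = (p.hom† ≫ p.hom) ≫ k.hom := by rw [← hk]; simp
        _ ≤ k.hom := comp_le_of_le_id (dagger_comp_le_id p) _
    have hl : leftAdjoints D (e.hom† ≫ k.hom) := by
      rw [leftAdjoints_iff]
      constructor
      · calc 𝟙 Y.obj ≤ e.hom† ≫ e.hom := he
          _ ≤ e.hom† ≫ ((k.hom ≫ k.hom†) ≫ e.hom) := by
            gcongr; exact le_comp_of_id_le (id_le_comp_dagger k) _
          _ = _ := by simp [dagger_comp, dagger_dagger]
      · calc (e.hom† ≫ k.hom)† ≫ (e.hom† ≫ k.hom) = k.hom† ≫ (e.hom ≫ (e.hom† ≫ k.hom)) := by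
              simp [dagger_comp, dagger_dagger]
          _ ≤ k.hom† ≫ k.hom := by gcongr
          _ ≤ 𝟙 V.obj := dagger_comp_le_id k
    exact ⟨⟨_, hl⟩, eq_of_hom_le h₁⟩
  have hepi : ∀ {V : LAdj D} {a b : Y ⟶ V}, e ≫ a = e ≫ b → a = b := by
    intro V a b hab
    refine eq_of_hom_le ?_
    calc a.hom ≤ (e.hom† ≫ e.hom) ≫ a.hom := le_comp_of_id_le he _
      _ = e.hom† ≫ (e ≫ a).hom := by simp
      _ = (e.hom† ≫ e.hom) ≫ b.hom := by rw [hab]; simp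
      _ ≤ b.hom := comp_le_of_le_id (dagger_comp_le_id e) _
  exact isRegularEpi_of_regularEpi
    { W := Z
      left := p
      right := q
      w := h.isPullback.w
      isColimit := Cofork.IsColimit.mk _ (fun s => (hdesc s.π s.condition).choose)
        (fun s => (hdesc s.π s.condition).choose_spec)
        (fun s m hm => hepi (hm.trans (hdesc s.π s.condition).choose_spec.symm)) }

/-- Surjective left adjoints are stable under pullback. -/
theorem IsTabulation.id_le {X Y Z W : LAdj D} {f : X ⟶ W} {g : Y ⟶ W} {p : Z ⟶ X} {q : Z ⟶ Y}
    (h : IsTabulation (f.hom ≫ g.hom†) p q) (hf : 𝟙 W.obj ≤ f.hom† ≫ f.hom) :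
    𝟙 Y.obj ≤ q.hom† ≫ q.hom := by
  have h₁ : 𝟙 Y.obj ≤ q.hom† ≫ (p.hom ≫ (p.hom† ≫ q.hom)) :=
    calc 𝟙 Y.obj ≤ g.hom ≫ g.hom† := id_le_comp_dagger g
      _ ≤ g.hom ≫ ((f.hom† ≫ f.hom) ≫ g.hom†) := by gcongr; exact le_comp_of_id_le hf _
      _ = (f.hom ≫ g.hom†)† ≫ (f.hom ≫ g.hom†) := by simp [dagger_comp, dagger_dagger]
      _ = _ := by rw [← h.dagger_comp_eq]; simp [dagger_comp, dagger_dagger]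
  -- For the factors q† and p p† q, the mutually reciprocal parts lie below q† and q, so the middle
  -- p p† disappears.
  refine (id_le_meet_comp_meet h₁).trans (comp_mono (meet_le_left _ _) ?_)
  exact (meet_le_right _ _).trans (dagger_dagger _).le

theorem id_le_of_isIso {X Y : LAdj D} (f : X ⟶ Y) [IsIso f] : 𝟙 Y.obj ≤ f.hom† ≫ f.hom := by
  have h : 𝟙 Y.obj = (inv f).hom ≫ f.hom := by
    rw [← WideSubcategory.comp_def, IsIso.inv_hom_id]; rfl
  have h' : (inv f).hom = f.hom† := by
    refine eq_dagger ?_ h.symm.le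
    rw [← WideSubcategory.comp_def, IsIso.hom_inv_id]; rfl
  rw [h, h']

/-! ### Regularity from tabulations and images -/

variable (D) in
/-- The allegory is tabular and its left adjoints have images; the images are given as
factorizations into a surjective left adjoint and a monomorphism. -/
structure IsTabular : Prop where
  exists_isTabulation : ∀ {X Y : LAdj D} (r : X.obj ⟶ Y.obj),
    ∃ (Z : LAdj D) (p : Z ⟶ X) (q : Z ⟶ Y), IsTabulation r p q
  exists_image : ∀ {X Y : LAdj D} (f : X ⟶ Y), ∃ (I : LAdj D) (e : X ⟶ I) (m : I ⟶ Y),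
    𝟙 I.obj ≤ e.hom† ≫ e.hom ∧ Mono m ∧ e ≫ m = f

namespace IsTabular

variable (hD : IsTabular D)
include hD

/-- For a regular epimorphism, the mono part of the image factorization is also a strong
epimorphism, hence invertible, so f is as surjective as its first factor. The converse uses a
tabulation of the kernel of f. -/
theorem isRegularEpi_iff {X Y : LAdj D} (f : X ⟶ Y) :
    IsRegularEpi f ↔ 𝟙 Y.obj ≤ f.hom† ≫ f.hom := by
  constructor
  · intro hf
    obtain ⟨I, e, m, he, hm, rfl⟩ := hD.exists_image f
    have : StrongEpi (e ≫ m) := inferInstance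
    have : StrongEpi m := strongEpi_of_strongEpi e m
    have : IsIso m := isIso_of_mono_of_strongEpi m
    calc 𝟙 Y.obj ≤ m.hom† ≫ m.hom := id_le_of_isIso m
      _ ≤ m.hom† ≫ ((e.hom† ≫ e.hom) ≫ m.hom) := by gcongr; exact le_comp_of_id_le he _
      _ = _ := by simp [dagger_comp]
  · intro hf
    obtain ⟨Z, p, q, h⟩ := hD.exists_isTabulation (f.hom ≫ f.hom†)
    exact isRegularEpi_of_id_le h hf

theorem hasPullbacks : HasPullbacks (LAdj D) := by
  refine @hasPullbacks_of_hasLimit_cospan _ _ fun {X Y Z f g} => ?_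
  obtain ⟨W, p, q, h⟩ := hD.exists_isTabulation (f.hom ≫ g.hom†)
  exact h.isPullback.hasPullback

/-- The category of left adjoints in a tabular allegory with images and with a terminal object is
regular. -/
theorem regular [HasTerminal (LAdj D)] : Regular (LAdj D) := by
  have := hD.hasPullbacks
  have : HasFiniteLimits (LAdj D) := hasFiniteLimits_of_hasTerminal_and_pullbacks
  refine ⟨fun {X Y Z f g₁ g₂} h => ?_, ⟨fun {X Y Y' S f g f' g'} h hg => ?_⟩⟩
  -- A kernel pair of e m with m mono is one of e, and a regular epimorphism is the coequalizer of
  -- its kernel pair.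
  · obtain ⟨I, e, m, he, hm, rfl⟩ := hD.exists_image f
    have : IsRegularEpi e := (hD.isRegularEpi_iff e).2 he
    exact ⟨⟨_, (IsKernelPair.cancel_right_of_mono h).toCoequalizer'⟩⟩
  · obtain ⟨Z, p, q, ht⟩ := hD.exists_isTabulation (g.hom ≫ f.hom†)
    have hq : IsRegularEpi q := (hD.isRegularEpi_iff q).2 (ht.id_le ((hD.isRegularEpi_iff g).1 hg))
    -- The given pullback is isomorphic to the tabulating one, where stability is known.
    rw [← IsPullback.isoIsPullback_hom_snd _ _ h ht.isPullback]
    exact MorphismProperty.RespectsIso.precomp _ _ _ hq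

end IsTabular

end Allegory

/-! ## The allegory of internal relations -/

namespace AjaxFunctor

variable {C : Type u} [Category.{v} C] [CartesianMonoidalCategory C] [HasPullbacks C] [HasImages C]
  (P : AjaxFunctor.{w} C)

theorem le_pull_push {X Y : C} (f : X ⟶ Y) (a : P.obj X) : a ≤ P.pull f (P.push f a) :=
  (P.gc f).le_u_l a

/-- Elimination rule for the existential quantifier in a composite, by adjunction;
`inf_le_pull_relComp` is the matching introduction rule, with `b` as witness. -/
theorem relComp_le_iff {X Y Z : C} {R : P.obj (X ⊗ Y)} {S : P.obj (Y ⊗ Z)} {U : P.obj (X ⊗ Z)} :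
    P.relComp R S ≤ U ↔
      P.pull (lift (fst X (Y ⊗ Z)) (snd _ _ ≫ fst _ _)) R ⊓ P.pull (snd _ _) S ≤
        P.pull (lift (fst _ _) (snd _ _ ≫ snd _ _)) U := by
  rw [relComp_eq, P.gc _ _ _]

/-- If `R(a, b)` and `S(b, c)`, then `(R ⨟ S)(a, c)`. -/
theorem inf_le_pull_relComp {A X Y Z : C} (a : A ⟶ X) (b : A ⟶ Y) (c : A ⟶ Z)
    (R : P.obj (X ⊗ Y)) (S : P.obj (Y ⊗ Z)) :
    P.pull (lift a b) R ⊓ P.pull (lift b c) S ≤ P.pull (lift a c) (P.relComp R S) := by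
  have h := (P.pull (lift a (lift b c))).monotone (P.relComp_le_iff.1 (le_refl (P.relComp R S)))
  rw [pull_inf, pull_pull, pull_pull, pull_pull] at h
  simpa using h

/-- The symmetry is its own inverse, so this is Beck–Chevalley for a square of isomorphisms. In this
form transposition is a substitution of variables. -/
theorem transpose_eq_pull {X Y : C} (R : P.obj (X ⊗ Y)) :
    P.transpose R = P.pull (lift (snd Y X) (fst Y X)) R := by
  have sq : IsPullback (lift (snd Y X) (fst Y X)) (𝟙 _) (lift (snd X Y) (fst X Y)) (𝟙 _) :=
    isPullback_of (by simp) (fun a b h => ⟨b, by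
      have h₁ := h =≫ fst _ _
      have h₂ := h =≫ snd _ _
      simp at h₁ h₂
      constructor
      · ext <;> simp [← h₁, ← h₂]
      · simp⟩) (fun l l' _ h => by simpa using h)
  have h := P.pull_push sq R
  rwa [pull_id, push_id] at h

theorem transpose_mono {X Y : C} {R S : P.obj (X ⊗ Y)} (h : R ≤ S) :
    P.transpose R ≤ P.transpose S := (P.push _).monotone h

@[simp]
theorem pull_transpose {A X Y : C} (a : A ⟶ X) (b : A ⟶ Y) (R : P.obj (Y ⊗ X)) :
    P.pull (lift a b) (P.transpose R) = P.pull (lift b a) R := by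
  simp [transpose_eq_pull, pull_pull]

theorem transpose_transpose {X Y : C} (R : P.obj (X ⊗ Y)) : P.transpose (P.transpose R) = R := by
  rw [transpose_eq_pull P (P.transpose R), pull_transpose]
  simp [pull_id]

theorem relComp_transpose_le {X Y Z : C} (R : P.obj (X ⊗ Y)) (S : P.obj (Y ⊗ Z)) :
    P.relComp (P.transpose S) (P.transpose R) ≤ P.transpose (P.relComp R S) := by
  have h := P.inf_le_pull_relComp (snd Z (Y ⊗ X) ≫ snd Y X) (snd _ _ ≫ fst _ _) (fst _ _) R S
  rw [relComp_le_iff, pull_transpose, pull_transpose, inf_comm]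
  refine le_trans (le_of_eq ?_) h
  congr 1
  rw [transpose_eq_pull, pull_pull]
  simp

theorem transpose_relComp {X Y Z : C} (R : P.obj (X ⊗ Y)) (S : P.obj (Y ⊗ Z)) :
    P.transpose (P.relComp R S) = P.relComp (P.transpose S) (P.transpose R) := by
  refine le_antisymm ?_ (P.relComp_transpose_le R S)
  have h := P.transpose_mono (P.relComp_transpose_le (P.transpose S) (P.transpose R))
  simpa only [transpose_transpose] using h

/-- The modular law. -/
theorem relComp_inf_le {X Y Z : C} (R : P.obj (X ⊗ Y)) (S : P.obj (Y ⊗ Z)) (U : P.obj (X ⊗ Z)) :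
    P.relComp R S ⊓ U ≤ P.relComp (R ⊓ P.relComp U (P.transpose S)) S := by
  have h := P.inf_le_pull_relComp (fst X (Y ⊗ Z)) (snd _ _ ≫ snd _ _) (snd _ _ ≫ fst _ _) U
    (P.transpose S)
  -- Frobenius moves U under the quantifier over y. There U(x, z) and S(y, z) yield (U ⨟ S°)(x, y),
  -- with z as witness.
  rw [relComp_eq, relComp_eq, ← push_inf_pull]
  refine (P.push _).monotone ?_
  rw [pull_inf]
  refine le_inf (le_inf (inf_le_left.trans inf_le_left) (le_trans ?_ h))
    (inf_le_left.trans inf_le_right)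
  rw [pull_transpose]
  refine le_inf inf_le_right ((inf_le_left.trans inf_le_right).trans (le_of_eq ?_))
  congr 2
  ext <;> simp

/-! ### Graphs and spans -/

/-- The graph of `f` restricted to the predicate `φ`. -/
noncomputable def relGraph {X Y : C} (f : X ⟶ Y) (φ : P.obj X) : P.obj (X ⊗ Y) :=
  P.push (lift (𝟙 X) f) φ

theorem transpose_relGraph {X Y : C} (f : X ⟶ Y) (φ : P.obj X) :
    P.transpose (P.relGraph f φ) = P.push (lift f (𝟙 X)) φ := by
  simp [transpose, relGraph, push_push]

theorem relId_le_relGraph_comp {X Y : C} (f : X ⟶ Y) (φ : P.obj X) :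
    P.relId φ ≤ P.relComp (P.relGraph f φ) (P.transpose (P.relGraph f φ)) := by
  rw [relId, P.gc _ _ _]
  refine le_trans ?_ (P.inf_le_pull_relComp (𝟙 X) f (𝟙 X) _ _)
  rw [pull_transpose, inf_idem]
  exact P.le_pull_push _ _

/-- Triples (x, y, z) with (x, y) = (f a, g a) amount to pairs (a, z). Beck–Chevalley along this
square replaces the quantified y by a, and Frobenius brings S inside. -/
theorem push_relComp_push {A X Y Z : C} (f : A ⟶ X) (g : A ⟶ Y) (φ : P.obj A) (S : P.obj (Y ⊗ Z)) :
    P.relComp (P.push (lift f g) φ) S =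
      P.push (f ⊗ₘ 𝟙 Z) (P.pull (fst A Z) φ ⊓ P.pull (g ⊗ₘ 𝟙 Z) S) := by
  have sq : IsPullback (fst A Z) (lift (fst A Z ≫ f) (g ⊗ₘ 𝟙 Z)) (lift f g)
      (lift (fst X (Y ⊗ Z)) (snd _ _ ≫ fst _ _)) :=
    isPullback_of (by ext <;> simp)
      (fun a b h => ⟨lift a (b ≫ snd _ _ ≫ snd _ _), by
        have h₁ := h =≫ fst _ _
        have h₂ := h =≫ snd _ _
        simp at h₁ h₂
        constructor
        · simp
        · ext <;> simp [h₁, h₂]⟩)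
      (fun l l' h h' => by
        have h₁ := h' =≫ (snd _ _ ≫ snd _ _)
        simp at h₁
        exact CartesianMonoidalCategory.hom_ext _ _ h h₁)
  rw [relComp_eq, P.pull_push sq, ← push_inf_pull, push_push, pull_pull]
  congr 2
  · ext <;> simp
  · simp

/-- The composite of the relations given by the spans `X ← A ⟶ A` and `A ⟵ A ⟶ Y`. -/
theorem push_relComp_relGraph {A X Y : C} (f : A ⟶ X) (g : A ⟶ Y) (φ ψ : P.obj A) :
    P.relComp (P.push (lift f (𝟙 A)) φ) (P.relGraph g ψ) = P.push (lift f g) (ψ ⊓ φ) := by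
  rw [push_relComp_push, relGraph, inf_comm]
  simp only [tensorHom_id, id_whiskerRight, pull_id]
  rw [← push_inf_pull, push_push, pull_pull]
  simp [pull_id]

theorem relGraph_comp_le {X Y : C} (f : X ⟶ Y) {φ : P.obj X} {ψ : P.obj Y} (h : P.push f φ ≤ ψ) :
    P.relComp (P.transpose (P.relGraph f φ)) (P.relGraph f φ) ≤ P.relId ψ := by
  rw [transpose_relGraph, push_relComp_relGraph, inf_idem, relId]
  have := (P.push (lift (𝟙 Y) (𝟙 Y))).monotone h
  rw [push_push] at this
  simpa using this

theorem relGraph_fst_comp_relGraph_snd {X Y : C} (θ : P.obj (X ⊗ Y)) :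
    P.relComp (P.transpose (P.relGraph (fst X Y) θ)) (P.relGraph (snd X Y) θ) = θ := by
  rw [transpose_relGraph, push_relComp_relGraph, inf_idem]
  simp [push_id]

/-! ### Internal equality -/

@[simp]
theorem transpose_relId {X : C} (φ : P.obj X) : P.transpose (P.relId φ) = P.relId φ := by
  simp [transpose, relId, push_push]

theorem relId_mono {X : C} {φ ψ : P.obj X} (h : φ ≤ ψ) : P.relId φ ≤ P.relId ψ :=
  (P.push _).monotone h

theorem le_pull_diag_relId {X : C} (φ : P.obj X) : φ ≤ P.pull (lift (𝟙 X) (𝟙 X)) (P.relId φ) :=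
  P.le_pull_push _ _

theorem top_le_pull_relId {A X : C} (a : A ⟶ X) : ⊤ ≤ P.pull (lift a a) (P.relId ⊤) := by
  have h := (P.pull a).monotone (P.le_pull_diag_relId (⊤ : P.obj X))
  rw [pull_pull, (P.gc a).u_top] at h
  simpa using h

/-- Equality is symmetric and transitive. -/
theorem pull_relId_inf_le {A X : C} (a b c : A ⟶ X) :
    P.pull (lift a b) (P.relId ⊤) ⊓ P.pull (lift c b) (P.relId ⊤) ≤
      P.pull (lift a c) (P.relId ⊤) := by
  have h := P.inf_le_pull_relComp a b c (P.relId ⊤) (P.relId ⊤)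
  rw [P.relId_comp le_top] at h
  rwa [← P.pull_transpose c b, P.transpose_relId] at h

/-- Equality of pairs is componentwise equality. -/
theorem pull_relId_inf_le_prod {A X Y : C} (a b : A ⟶ X) (c d : A ⟶ Y) :
    P.pull (lift a b) (P.relId ⊤) ⊓ P.pull (lift c d) (P.relId ⊤) ≤
      P.pull (lift (lift a c) (lift b d)) (P.relId ⊤) := by
  have h : P.pull (fst (X ⊗ X) (Y ⊗ Y)) (P.relId ⊤) ⊓ P.pull (snd _ _) (P.relId ⊤) ≤
      P.pull (lift (lift (fst _ _ ≫ fst _ _) (snd _ _ ≫ fst _ _))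
        (lift (fst _ _ ≫ snd _ _) (snd _ _ ≫ snd _ _))) (P.relId ⊤) := by
    -- By naturality of the laxator the left side is a pushforward along a product of two diagonals.
    -- After adjunction only reflexivity on X ⊗ Y remains.
    rw [← lax_eq, relId, relId, ← push_lax, P.gc _ _ _, pull_pull]
    refine le_top.trans ((P.top_le_pull_relId (𝟙 _)).trans (le_of_eq ?_))
    congr 2
    ext <;> simp
  have h' := (P.pull (lift (lift a b) (lift c d))).monotone h
  rw [pull_inf, pull_pull, pull_pull, pull_pull] at h'
  simpa using h'

theorem relGraph_le {X Y : C} (f : X ⟶ Y) (φ : P.obj X) :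
    P.relGraph f φ ≤ P.pull (f ⊗ₘ 𝟙 Y) (P.relId ⊤) := by
  rw [relGraph, P.gc _ _ _, pull_pull]
  refine le_top.trans ((P.top_le_pull_relId f).trans (le_of_eq ?_))
  simp

/-- The images under f of the two outer points both equal the middle point, hence each other. -/
theorem relGraph_comp_transpose_le {X Y : C} (f : X ⟶ Y) (φ : P.obj X) :
    P.relComp (P.relGraph f φ) (P.transpose (P.relGraph f φ)) ≤
      P.pull (f ⊗ₘ f) (P.relId ⊤) := by
  have hle : ∀ {A : C} (a : A ⟶ X) (b : A ⟶ Y), P.pull (lift a b) (P.relGraph f φ) ≤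
      P.pull (lift (a ≫ f) b) (P.relId ⊤) := fun a b => by
    have h := (P.pull (lift a b)).monotone (P.relGraph_le f φ)
    rw [pull_pull] at h
    simpa using h
  have h := P.pull_relId_inf_le (fst X (Y ⊗ X) ≫ f) (snd _ _ ≫ fst _ _) (snd _ _ ≫ snd _ _ ≫ f)
  rw [relComp_le_iff, transpose_eq_pull, pull_pull, pull_pull]
  refine (inf_le_inf (hle _ _) ?_).trans (h.trans (le_of_eq ?_))
  · have h₁ := hle (snd X (Y ⊗ X) ≫ snd Y X) (snd _ _ ≫ fst _ _)
    simpa using h₁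
  · simp

/-- By Frobenius, `relId φ` is the meet of the unrestricted equality with φ on one variable. The
equality and the predicate can thus be checked separately. -/
theorem le_relId_of_push_fst_le {X : C} {φ : P.obj X} {R : P.obj (X ⊗ X)} (h : R ≤ P.relId ⊤)
    (h' : P.push (fst X X) R ≤ φ) : R ≤ P.relId φ := by
  have h₁ := le_inf h ((P.gc _ _ _).1 h')
  rw [relId, ← push_inf_pull, pull_pull] at h₁
  simp only [lift_fst, pull_id, top_inf_eq] at h₁
  exact h₁

theorem le_relId_of_push_snd_le {X : C} {φ : P.obj X} {R : P.obj (X ⊗ X)} (h : R ≤ P.relId ⊤)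
    (h' : P.push (snd X X) R ≤ φ) : R ≤ P.relId φ := by
  have h₁ := le_inf h ((P.gc _ _ _).1 h')
  rw [relId, ← push_inf_pull, pull_pull] at h₁
  simp only [lift_snd, pull_id, top_inf_eq] at h₁
  exact h₁

/-- Joint monicity of the two projections: pairs that agree in both components are equal. -/
theorem relGraph_fst_inf_relGraph_snd_le {X Y : C} (θ : P.obj (X ⊗ Y)) :
    P.relComp (P.relGraph (fst X Y) θ) (P.transpose (P.relGraph (fst X Y) θ)) ⊓
      P.relComp (P.relGraph (snd X Y) θ) (P.transpose (P.relGraph (snd X Y) θ)) ≤ P.relId θ := by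
  refine P.le_relId_of_push_fst_le ?_ ?_
  · refine (inf_le_inf (P.relGraph_comp_transpose_le _ _)
      (P.relGraph_comp_transpose_le _ _)).trans ?_
    have h := P.pull_relId_inf_le_prod (fst (X ⊗ Y) (X ⊗ Y) ≫ fst X Y) (snd _ _ ≫ fst _ _)
      (fst _ _ ≫ snd _ _) (snd _ _ ≫ snd _ _)
    have h₁ : lift (lift (fst (X ⊗ Y) (X ⊗ Y) ≫ fst X Y) (fst _ _ ≫ snd _ _))
        (lift (snd _ _ ≫ fst _ _) (snd _ _ ≫ snd _ _)) = 𝟙 _ := by ext <;> simp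
    rw [h₁, pull_id] at h
    convert h using 3 <;> ext <;> simp
  · refine ((P.push _).monotone inf_le_left).trans ((P.push_fst_relComp_le _ _).trans ?_)
    simp [relGraph, push_push, push_id]

/-- The kernel-dual `R° ⨟ R` of a relation contains the equality on its image. -/
theorem relId_push_snd_le {X Y : C} (R : P.obj (X ⊗ Y)) :
    P.relId (P.push (snd X Y) R) ≤ P.relComp (P.transpose R) R := by
  -- By adjunction it suffices to treat a pair with R(x, y), and there x is the witness relating y
  -- to itself.
  rw [relId, P.gc _ _ _, P.gc _ _ _, pull_pull]
  have h := P.inf_le_pull_relComp (snd X Y) (fst X Y) (snd X Y) (P.transpose R) R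
  rw [pull_transpose, inf_idem, lift_fst_snd, pull_id] at h
  simpa using h

/-- The two projections to the terminal object coincide, so reflexivity already covers all pairs. -/
theorem relId_top_unit : P.relId (⊤ : P.obj (𝟙_ C)) = ⊤ := by
  have h := P.top_le_pull_relId (fst (𝟙_ C) (𝟙_ C))
  have h₁ : lift (fst (𝟙_ C) (𝟙_ C)) (fst _ _) = 𝟙 _ := by
    ext
  rw [h₁, pull_id] at h
  exact top_le_iff.1 h

end AjaxFunctor

/-! ### The tabular allegory of internal relations -/

namespace IntRel

variable {C : Type u} [Category.{v} C] [CartesianMonoidalCategory C] [HasPullbacks C] [HasImages C]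
  {P : AjaxFunctor.{w} C}

noncomputable instance : Allegory (IntRel P) where
  dagger f := ⟨P.transpose f.rel,
    by simpa [AjaxFunctor.transpose, AjaxFunctor.push_push] using f.push_snd_le,
    by simpa [AjaxFunctor.transpose, AjaxFunctor.push_push] using f.push_fst_le⟩
  dagger_dagger f := Hom.ext (P.transpose_transpose f.rel)
  dagger_mono h := P.transpose_mono h
  dagger_comp f g := Hom.ext (P.transpose_relComp f.rel g.rel)
  meet f g := ⟨f.rel ⊓ g.rel, ((P.push _).monotone inf_le_left).trans f.push_fst_le,
    ((P.push _).monotone inf_le_left).trans f.push_snd_le⟩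
  meet_le_left f g := (inf_le_left : f.rel ⊓ g.rel ≤ f.rel)
  meet_le_right f g := (inf_le_right : f.rel ⊓ g.rel ≤ g.rel)
  le_meet {X Y f g h} hg hh := (le_inf hg hh : f.rel ≤ g.rel ⊓ h.rel)
  modular r s t := P.relComp_inf_le r.rel s.rel t.rel

end IntRel

namespace InternalFunctions

open PoCategory

variable {C : Type u} [Category.{v} C] [CartesianMonoidalCategory C] [HasPullbacks C] [HasImages C]
  {P : AjaxFunctor.{w} C}

/-- The internal function given by a total and single-valued relation. -/
def homMk {A B : InternalFunctions P} (R : P.obj (ctx A ⊗ ctx B))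
    (h₁ : P.push (fst _ _) R ≤ A.obj.pred) (h₂ : P.push (snd _ _) R ≤ B.obj.pred)
    (h₃ : P.relId A.obj.pred ≤ P.relComp R (P.transpose R))
    (h₄ : P.relComp (P.transpose R) R ≤ P.relId B.obj.pred) : A ⟶ B :=
  ⟨⟨R, h₁, h₂⟩, Allegory.leftAdjoints_iff.2 ⟨h₃, h₄⟩⟩

/-- The internal function given by a morphism of contexts. -/
noncomputable def ofHom {A B : InternalFunctions P} (f : ctx A ⟶ ctx B)
    (h : P.push f A.obj.pred ≤ B.obj.pred) : A ⟶ B :=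
  homMk (P.relGraph f A.obj.pred)
    (by simp [AjaxFunctor.relGraph, AjaxFunctor.push_push, AjaxFunctor.push_id])
    (by simpa [AjaxFunctor.relGraph, AjaxFunctor.push_push] using h)
    (P.relId_le_relGraph_comp f _) (P.relGraph_comp_le f h)

theorem isTabulation {A B : InternalFunctions P} (r : A.obj ⟶ B.obj) :
    Allegory.IsTabulation r (ofHom (A := of _ r.rel) (fst _ _) r.push_fst_le)
      (ofHom (A := of _ r.rel) (snd _ _) r.push_snd_le) where
  dagger_comp_eq := IntRel.Hom.ext (P.relGraph_fst_comp_relGraph_snd r.rel)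
  meet_le := P.relGraph_fst_inf_relGraph_snd_le r.rel

variable {A B : InternalFunctions P}

theorem im_le (f : A ⟶ B) : im f ≤ B.obj.pred := f.hom.push_snd_le

/-- The corestriction of an internal function to its image. -/
noncomputable def toIm (f : A ⟶ B) : A ⟶ of _ (im f) :=
  homMk (B := of _ (im f)) f.hom.rel f.hom.push_fst_le le_rfl (Allegory.id_le_comp_dagger f)
    -- Single-valuedness is needed over the smaller predicate `im f`: equality comes from f, and the
    -- composite ranges in the image.
    (P.le_relId_of_push_snd_le
      ((show P.relComp (P.transpose (rel f)) (rel f) ≤ P.relId B.obj.pred from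
        Allegory.dagger_comp_le_id f).trans (P.relId_mono le_top))
      (P.push_snd_relComp_le _ _))

/-- The inclusion of the image of an internal function. -/
noncomputable def imι (f : A ⟶ B) : of _ (im f) ⟶ B :=
  ofHom (𝟙 _) ((P.push_id _).le.trans (im_le f))

theorem toIm_imι (f : A ⟶ B) : toIm f ≫ imι f = f :=
  WideSubcategory.hom_ext _ (IntRel.Hom.ext (P.relComp_id (φ := im f) le_rfl))

theorem id_le_toIm (f : A ⟶ B) :
    𝟙 (of _ (im f)).obj ≤ Allegory.dagger (toIm f).hom ≫ (toIm f).hom :=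
  P.relId_push_snd_le (rel f)

instance (f : A ⟶ B) : Mono (imι f) := by
  refine Allegory.mono_of_comp_dagger_le ?_
  change P.relComp (P.relId (im f)) (P.transpose (P.relId (im f))) ≤ P.relId (im f)
  rw [P.transpose_relId, P.relId_comp]
  simp [AjaxFunctor.relId, AjaxFunctor.push_push, AjaxFunctor.push_id]

variable (P) in
theorem isTabular : Allegory.IsTabular (IntRel P) where
  exists_isTabulation r := ⟨_, _, _, isTabulation r⟩
  exists_image f := ⟨_, toIm f, imι f, id_le_toIm f, inferInstance, toIm_imι f⟩

instance (f : A ⟶ B) : IsRegularEpi (toIm f) :=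
  ((isTabular P).isRegularEpi_iff _).2 (id_le_toIm f)

variable (P) in
/-- The unit context with the predicate `true` is terminal. -/
noncomputable def isTerminal : IsTerminal (of (P := P) (𝟙_ C) ⊤) :=
  IsTerminal.ofUniqueHom (fun A => ofHom (toUnit _) le_top) fun A m => by
    refine Allegory.eq_of_dagger_comp_le ?_
    -- Uniqueness costs nothing, since the identity of this object is the largest relation on it.
    change _ ≤ P.relId ⊤
    rw [P.relId_top_unit]
    exact le_top

end InternalFunctions

/-- The category of internal functions of a regular calculus is regular. The terminal object,
pullbacks and image factorizations are moreover given by the explicit formulas below. -/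
theorem theorem7p3 {T : Type u} (P : RegularCalculus.{w} T) :
    Regular (InternalFunctions P) ∧
    Nonempty (IsTerminal (InternalFunctions.of (P := P) (𝟙_ (FRg T)) ⊤)) ∧
    (∀ {A B D : InternalFunctions P} (f : A ⟶ D) (g : B ⟶ D)
      (θ : P.obj (InternalFunctions.ctx A ⊗ InternalFunctions.ctx B)),
      θ = P.relComp (InternalFunctions.rel f) (P.transpose (InternalFunctions.rel g)) →
      ∃ (p : InternalFunctions.of _ θ ⟶ A) (q : InternalFunctions.of _ θ ⟶ B),
        InternalFunctions.rel p = P.push (lift (𝟙 _) (fst _ _)) θ ∧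
        InternalFunctions.rel q = P.push (lift (𝟙 _) (snd _ _)) θ ∧
        IsPullback p q f g) ∧
    (∀ {A B : InternalFunctions P} (f : A ⟶ B),
      ∃ (e : A ⟶ InternalFunctions.of _ (InternalFunctions.im f))
        (m : InternalFunctions.of _ (InternalFunctions.im f) ⟶ B),
        InternalFunctions.rel e = InternalFunctions.rel f ∧
        InternalFunctions.rel m = P.relId (InternalFunctions.im f) ∧
        IsRegularEpi e ∧ Mono m ∧ e ≫ m = f) := by
  have hT := InternalFunctions.isTerminal P
  have := hT.hasTerminal
  refine ⟨(InternalFunctions.isTabular P).regular, ⟨hT⟩, ?_, fun f =>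
    ⟨InternalFunctions.toIm f, InternalFunctions.imι f, rfl, rfl, inferInstance, inferInstance,
      InternalFunctions.toIm_imι f⟩⟩
  rintro A B D f g _ rfl
  -- By definition θ is the element underlying f g†, so the tabulation of f g† has the prescribed
  -- apex and legs.
  exact ⟨_, _, rfl, rfl,
    (InternalFunctions.isTabulation (f.hom ≫ Allegory.dagger g.hom)).isPullback⟩
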